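/- All logarithms, entropies and information densities are to base $2$. For a pair of random variables $(A,B)$ with joint law $P_{AB}$, write $\imath_{A;B}(a;b)=\log\frac{\mathrm dP_{AB}}{\mathrm d(P_A\times P_B)}(a,b)$, with $\log 0=-\infty$ and with the usual convention that the density is $+\infty$ on a $P_A\times P_B$-null set carrying the part of $P_{AB}$ that is singular with respect to $P_A\times P_B$. A key generation scheme for a source $(X,Y,Z)\sim P_{XYZ}$ consists of a stochastic encoder $P_{WK|X}$, with $W\in\mathcal W$ and $K\in\mathcal K$ (finite sets) generated from $X$ so that $(W,K)-X-(Y,Z)$ is a Markov chain, and a decoder $\hat K=\hat K(W,Y)\in\mathcal K$. **Theorem.** Let $P_{XYZ}$ be a probability distribution, let $M,M_1,M_2>0$ be integers, and let $\bar P_{U|X}$ be a conditional distribution on an arbitrary alphabet $\mathcal U$. Put $\bar P_{UXYZ}=\bar P_{U|X}P_{XYZ}$, and, with all probabilities and information densities computed under $\bar P_{UXYZ}$, $$T_1=\inf_{\tau>0}\Big\{\mathbb P[\imath_{U;Z}(U;Z)>\tau]+\tfrac12\sqrt{\tfrac{2^\tau}{MM_2}}\Big\},\qquad T_2=\inf_{\tau>0}\Big\{\mathbb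 P[\imath_{U;Z}(U;Z)>\tau]+\tfrac12\sqrt{\tfrac{2^\tau}{M_2}}\Big\},$$ $$T_3=\inf_{\tau>0}\Big\{\mathbb P[\imath_{U;X}(U;X)>\tau]+\tfrac12\sqrt{\tfrac{2^\tau}{MM_1M_2}}\Big\},$$ $$\epsilon=\inf_{\gamma>0}\big\{\mathbb P[\imath_{U;Y}(U;Y)\le\log(M_1M_2-1)+\gamma]+2^{-\gamma}\big\},$$ $$\epsilon^*=2(T_3+\epsilon),\qquad T^*=4(T_1+T_2+3T_3).$$ Then there is a scheme with $|\mathcal W|=M$ and $|\mathcal K|=M_1$ such that $$\mathbb P(\hat K\ne K)\le\epsilon^*,\qquad \log M_1-H(K|W,Z)\le\inf_{0<\delta<e^{-1}M_1^{3/2}}\Big\{(T^*+8\delta)\log\frac{M_1^{3/2}}{\delta}\Big\}.$$ Moreover the encoder can be taken to be a likelihood encoder: there is a codebook $u(w,k,l)\in\mathcal U$, $1\le w\le M$, $1\le k\le M_1$, $1\le l\le M_2$, such that, given $X=x$, the pair $(W,K)$ is the $(w,k)$-part of a random index $(w,k,l)$ drawn with probability proportional to $f(u(w,k,l),x)$,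 where $f$ is (a version of) the density of the absolutely continuous part of $\bar P_{UX}$ with respect to $\bar P_U\times P_X$, i.e. the likelihood $\bar P_{X|U}(x|u)$ up to a factor that depends on $x$ only (and drawn uniformly for those $x$ for which all these values vanish). -/

import Mathlib

open MeasureTheory ProbabilityTheory
open scoped ENNReal

namespace OneShotKey

noncomputable section

/-- Base-two logarithm of an extended nonnegative number, with `log₂ 0 = -∞` and `log₂ ∞ = ∞`. -/
def log₂ (r : ℝ≥0∞) : EReal := ENNReal.log r / ((Real.log 2 : ℝ) : EReal)

open Classical in
/-- The likelihood ratio `dν/dπ`, extended by the usual convention that it is `∞` on a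
`π`-null set carrying the part of `ν` that is singular to `π`. If `ν ≪ π` this is `π`-almost
everywhere the Radon–Nikodym derivative. -/
def likelihoodRatio {A : Type*} [MeasurableSpace A] (ν π : Measure A) (a : A) : ℝ≥0∞ :=
  if a ∈ (Measure.mutuallySingular_singularPart ν π).nullSet then ν.rnDeriv π a else ∞

/-- The information density (in bits) of a joint law `ν` on `A × B`:
`log₂ (dν / d(ν_A × ν_B))`. -/
def infoDensity {A B : Type*} [MeasurableSpace A] [MeasurableSpace B]
    (ν : Measure (A × B)) (p : A × B) : EReal :=
  log₂ (likelihoodRatio ν (ν.fst.prod ν.snd) p)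

/-- `inf_{τ > 0} { ℙ[ı(A;B) > τ] + (1/2) √(2^τ / N) }` for `(A, B) ∼ ν`. -/
def coveringBound {A B : Type*} [MeasurableSpace A] [MeasurableSpace B]
    (ν : Measure (A × B)) (N : ℕ) : ℝ :=
  ⨅ τ : Set.Ioi (0 : ℝ),
    (ν.real {p | (((τ : ℝ)) : EReal) < infoDensity ν p}
      + 1 / 2 * Real.sqrt ((2 : ℝ) ^ (τ : ℝ) / (N : ℝ)))

/-- `inf_{γ > 0} { ℙ[ı(A;B) ≤ log₂ (N - 1) + γ] + 2^(-γ) }` for `(A, B) ∼ ν` and `N ≥ 1`. -/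
def decodingBound {A B : Type*} [MeasurableSpace A] [MeasurableSpace B]
    (ν : Measure (A × B)) (N : ℕ) : ℝ :=
  ⨅ γ : Set.Ioi (0 : ℝ),
    (ν.real {p | infoDensity ν p ≤ log₂ (((N - 1 : ℕ)) : ℝ≥0∞) + (((γ : ℝ)) : EReal)}
      + (2 : ℝ) ^ (-(γ : ℝ)))

/-- Conditional Shannon entropy `H(K | V)` in bits of a random variable `K` with finite
alphabet given an arbitrary random variable `V`: the mean over `v` of the entropy of the
conditional law of `K` given `V = v`. -/
def condEntropy {Ω S T : Type*} [MeasurableSpace Ω] [MeasurableSpace T]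
    [Fintype S] [Nonempty S] [MeasurableSpace S] [StandardBorelSpace S]
    (K : Ω → S) (V : Ω → T) (μ : Measure Ω) [IsFiniteMeasure μ] : ℝ :=
  ∫ v, (∑ k : S, Real.negMulLog ((condDistrib K V μ v).real {k})) / Real.log 2 ∂(μ.map V)

section TestChannel

variable {X Y Z U : Type*} [MeasurableSpace X] [MeasurableSpace Y] [MeasurableSpace Z]
  [MeasurableSpace U]

/-- The joint law of `((X, Y, Z), U)` when `(X, Y, Z) ∼ P` and `U` is obtained from `X` through
the test channel `Q = P̄_{U|X}`. -/
def testLaw (P : Measure (X × Y × Z)) (Q : Kernel X U) : Measure ((X × Y × Z) × U) :=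
  P ⊗ₘ (Q.comap Prod.fst measurable_fst)

/-- The law `P̄_{UX}`. -/
def lawUX (P : Measure (X × Y × Z)) (Q : Kernel X U) : Measure (U × X) :=
  (testLaw P Q).map (fun ω => (ω.2, ω.1.1))

/-- The law `P̄_{UY}`. -/
def lawUY (P : Measure (X × Y × Z)) (Q : Kernel X U) : Measure (U × Y) :=
  (testLaw P Q).map (fun ω => (ω.2, ω.1.2.1))

/-- The law `P̄_{UZ}`. -/
def lawUZ (P : Measure (X × Y × Z)) (Q : Kernel X U) : Measure (U × Z) :=
  (testLaw P Q).map (fun ω => (ω.2, ω.1.2.2))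

/-- `T₁`. -/
def T₁ (P : Measure (X × Y × Z)) (Q : Kernel X U) (M M₂ : ℕ) : ℝ :=
  coveringBound (lawUZ P Q) (M * M₂)

/-- `T₂`. -/
def T₂ (P : Measure (X × Y × Z)) (Q : Kernel X U) (M₂ : ℕ) : ℝ :=
  coveringBound (lawUZ P Q) M₂

/-- `T₃`. -/
def T₃ (P : Measure (X × Y × Z)) (Q : Kernel X U) (M M₁ M₂ : ℕ) : ℝ :=
  coveringBound (lawUX P Q) (M * M₁ * M₂)

/-- `ε* = 2 (T₃ + ε)`. -/
def εStar (P : Measure (X × Y × Z)) (Q : Kernel X U) (M M₁ M₂ : ℕ) : ℝ :=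
  2 * (T₃ P Q M M₁ M₂ + decodingBound (lawUY P Q) (M₁ * M₂))

/-- `T* = 4 (T₁ + T₂ + 3 T₃)`. -/
def TStar (P : Measure (X × Y × Z)) (Q : Kernel X U) (M M₁ M₂ : ℕ) : ℝ :=
  4 * (T₁ P Q M M₂ + T₂ P Q M₂ + 3 * T₃ P Q M M₁ M₂)

/-- The likelihood `P̄_{X|U}(x|u)`, as a density with respect to `P_X`. -/
def likelihood (P : Measure (X × Y × Z)) (Q : Kernel X U) (u : U) (x : X) : ℝ :=
  ((lawUX P Q).rnDeriv ((lawUX P Q).fst.prod (lawUX P Q).snd) (u, x)).toReal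

/-- The probability that the likelihood encoder with codebook `c` outputs the index `i` on
input `x`: proportional to the likelihood of `c i` given `x` (and uniform on those `x`
for which no codeword has positive likelihood, where there is nothing to normalize). -/
def likelihoodEncoder {I : Type*} [Fintype I] (P : Measure (X × Y × Z)) (Q : Kernel X U)
    (c : I → U) (x : X) (i : I) : ℝ :=
  if (∑ j, likelihood P Q (c j) x) = 0 then 1 / (Fintype.card I : ℝ)
  else likelihood P Q (c i) x / ∑ j, likelihood P Q (c j) x

end TestChannel

/-- A one-way key generation scheme with `|𝒲| = M` messages and `|𝒦| = M₁` keys: a stochastic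
encoder `P_{WK|X}` at terminal A and a decoder `K̂ = K̂(W, Y)` at terminal B. -/
structure Scheme (X Y : Type*) [MeasurableSpace X] [MeasurableSpace Y] (M M₁ : ℕ) where
  enc : Kernel X (Fin M × Fin M₁)
  isMarkovKernel_enc : IsMarkovKernel enc
  dec : Fin M × Y → Fin M₁
  measurable_dec : Measurable dec

attribute [instance] Scheme.isMarkovKernel_enc

namespace Scheme

variable {X Y Z : Type*} [MeasurableSpace X] [MeasurableSpace Y] [MeasurableSpace Z] {M M₁ : ℕ}

/-- The joint law of `((X, Y, Z), (W, K))` under the scheme. -/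
def law (S : Scheme X Y M M₁) (P : Measure (X × Y × Z)) :
    Measure ((X × Y × Z) × (Fin M × Fin M₁)) :=
  P ⊗ₘ (S.enc.comap Prod.fst measurable_fst)

instance (S : Scheme X Y M M₁) (P : Measure (X × Y × Z)) [IsProbabilityMeasure P] :
    IsProbabilityMeasure (S.law P) := by
  unfold law; infer_instance

/-- `ℙ(K̂ ≠ K)`. -/
def errorProb (S : Scheme X Y M M₁) (P : Measure (X × Y × Z)) : ℝ :=
  (S.law P).real {ω | S.dec (ω.2.1, ω.1.2.1) ≠ ω.2.2}

/-- `log₂ |𝒦| - H(K | W, Z)`. -/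
def leakage [NeZero M₁] (S : Scheme X Y M M₁) (P : Measure (X × Y × Z))
    [IsProbabilityMeasure P] : ℝ :=
  Real.logb 2 (M₁ : ℝ) - condEntropy (fun ω => ω.2.2) (fun ω => (ω.2.1, ω.1.2.2)) (S.law P)

end Scheme

end

end OneShotKey

namespace OneShotKey

/-! ### Base-two logarithms -/

/-! The codebook is drawn i.i.d. from the law of `U`, and the scheme is compared with an idealized
one in which the index is uniform on the `N = M * M₁ * M₂` codewords and the source is then
distributed according to the likelihood of the chosen codeword. Let `F` be the likelihood, `s i` the
encoder weights and `avg` the mean of `F` over the codebook. Then `s i * avg = F (c i) / N`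
(`encWeight_mul_codeAverage`), so the true measure `s i · P` and the ideal one `F (c i) / N · P`
differ by `s i * |1 - avg|`. The weights sum to one, so the total cost is `∫ |1 - avg|`.

Soft covering makes this small: truncate the density at `2 ^ τ`, then use a second moment bound
(`lintegral_ofReal_sub_average_le`). Only the deficit `1 - avg` is estimated directly; the excess is
no larger on average, because `avg` has mean at most one. This gives `T₃`.

Reliability: under the ideal law, maximum likelihood decoding among the codewords of the received
message costs the usual random coding bound `lintegral_confusion_le_decodingBound`. Secrecy: under
the ideal law, each pair `(w, k)` carries on `Z` the measure `1 / (M * M₁)` times an average of `M₂`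
output laws. Soft covering with `M₂` codewords puts it close to `P_Z / (M * M₁)`, at cost `T₂`. This
makes `(W, K)` jointly close to uniform and independent of `Z`, so no separate covering over
messages is needed, and `T₁` enters the final bound only as nonnegative slack.

No absolute continuity or countability of the alphabets is assumed. `F` is the density of the
absolutely continuous part only, so the ideal law may lose mass; the loss `singularMass` is at most
`T₃`, since the information density is infinite on the singular part. Output densities on `Z` come
from `exists_density_map` instead of a disintegration.

An averaging argument (`exists_le_two_mul`) yields one codebook good for both criteria at the price
of a factor two. Finally `logb_card_sub_condEntropy_le` turns near-uniformity of the key into an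
entropy bound. -/

theorem log₂_strictMono : StrictMono log₂ := by
  intro a b h
  exact EReal.div_lt_div_right_of_pos (by exact_mod_cast Real.log_pos one_lt_two)
    (EReal.coe_ne_top _) (ENNReal.log_lt_log h)

theorem log₂_two_rpow (t : ℝ) : log₂ (ENNReal.ofReal ((2 : ℝ) ^ t)) = (t : EReal) := by
  have h : Real.log 2 ≠ 0 := (Real.log_pos one_lt_two).ne'
  rw [log₂, ENNReal.log_ofReal_of_pos (by positivity), Real.log_rpow two_pos, ← EReal.coe_div,
    mul_div_cancel_right₀ _ h]

theorem log₂_mul (a b : ℝ≥0∞) : log₂ (a * b) = log₂ a + log₂ b := by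
  rw [log₂, ENNReal.log_mul_add, EReal.add_div_of_nonneg_right]
  · rfl
  · exact_mod_cast (Real.log_pos one_lt_two).le

/-! ### Densities -/

section Densities

variable {A B Ω T : Type*} [MeasurableSpace A] [MeasurableSpace B] [MeasurableSpace Ω]
  [MeasurableSpace T]

theorem measurable_fiber {f : A × Ω → ℝ≥0∞} (hf : Measurable f) (a : A) :
    Measurable fun ω => f (a, ω) := hf.comp measurable_prodMk_left

/-- The set on which `likelihoodRatio` is the Radon–Nikodym derivative. -/
def regularSet (ν π : Measure A) : Set A :=
  (Measure.mutuallySingular_singularPart ν π).nullSet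

theorem measurableSet_regularSet (ν π : Measure A) : MeasurableSet (regularSet ν π) :=
  Measure.MutuallySingular.measurableSet_nullSet _

theorem measure_compl_regularSet (ν π : Measure A) : π (regularSet ν π)ᶜ = 0 :=
  Measure.MutuallySingular.measure_compl_nullSet _

/-- In the Lebesgue decomposition the regular set is null for the singular part and has a `π`-null
complement, so restricting to it keeps exactly the absolutely continuous part. -/
theorem restrict_regularSet (ν π : Measure A) [IsFiniteMeasure ν] [SigmaFinite π] :
    ν.restrict (regularSet ν π) = π.withDensity (ν.rnDeriv π) := by
  have h1 : (ν.singularPart π).restrict (regularSet ν π) = 0 :=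
    Measure.MutuallySingular.restrict_nullSet _
  have h2 : (π.withDensity (ν.rnDeriv π)).restrict (regularSet ν π)
      = π.withDensity (ν.rnDeriv π) := by
    rw [Measure.restrict_eq_self_of_ae_mem]
    refine (withDensity_absolutelyContinuous _ _).ae_le ?_
    exact measure_compl_regularSet ν π
  have h3 := congrArg (fun m => m.restrict (regularSet ν π)) (Measure.singularPart_add_rnDeriv ν π)
  rw [← h3, Measure.restrict_add, h1, h2, zero_add]

theorem likelihoodRatio_of_mem {ν π : Measure A} {a : A} (h : a ∈ regularSet ν π) :
    likelihoodRatio ν π a = ν.rnDeriv π a := if_pos h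

theorem likelihoodRatio_of_notMem {ν π : Measure A} {a : A} (h : a ∉ regularSet ν π) :
    likelihoodRatio ν π a = ∞ := if_neg h

/-- A measure below `ν` and absolutely continuous with respect to `π` is below the absolutely
continuous part of `ν`. -/
theorem le_withDensity_rnDeriv {α ν π : Measure A} [IsFiniteMeasure ν] [SigmaFinite π]
    (h : α ≤ ν) (hα : α ≪ π) : α ≤ π.withDensity (ν.rnDeriv π) := by
  rw [← restrict_regularSet]
  calc α = α.restrict (regularSet ν π) := by
        rw [Measure.restrict_eq_self_of_ae_mem]
        exact hα (measure_compl_regularSet ν π)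
    _ ≤ _ := Measure.restrict_mono le_rfl h

/-- Choosing a Radon–Nikodym derivative separately for each `a` would lose joint measurability. On a
rectangle `S ×ˢ R` the dependence on `a` factors out and a single derivative serves every `a`; a π-λ
induction carries this to all measurable sets. -/
theorem exists_density_map_set (P : Measure Ω) [IsProbabilityMeasure P] {t : Ω → T}
    (ht : Measurable t) {E : Set (A × Ω)} (hE : MeasurableSet E) :
    ∃ g : A × T → ℝ≥0∞, Measurable g ∧ ∀ a, ∀ C, MeasurableSet C →
      ∫⁻ ω in t ⁻¹' C, E.indicator 1 (a, ω) ∂P = ∫⁻ z in C, g (a, z) ∂(P.map t) := by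
  have hPt : IsProbabilityMeasure (P.map t) := Measure.isProbabilityMeasure_map ht.aemeasurable
  induction E, hE using MeasurableSpace.induction_on_inter generateFrom_prod.symm
      isPiSystem_prod with
  | empty => exact ⟨0, measurable_zero, by simp⟩
  | basic E hE =>
    obtain ⟨S, hS, R, hR, rfl⟩ := hE
    have hac : (P.restrict R).map t ≪ P.map t :=
      (Measure.absolutelyContinuous_of_le Measure.restrict_le_self).map ht
    refine ⟨fun p => S.indicator 1 p.1 * ((P.restrict R).map t).rnDeriv (P.map t) p.2, ?_, ?_⟩
    · exact ((measurable_one.indicator hS).comp measurable_fst).mul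
        ((Measure.measurable_rnDeriv _ _).comp measurable_snd)
    · intro a C hC
      have h1 : ∀ ω, (S ×ˢ R).indicator (1 : A × Ω → ℝ≥0∞) (a, ω)
          = S.indicator 1 a * R.indicator 1 ω := by
        intro ω; by_cases h : a ∈ S <;> by_cases h' : ω ∈ R <;> simp [h, h']
      simp_rw [h1]
      rw [lintegral_const_mul _ (measurable_one.indicator hR),
        lintegral_const_mul _ (Measure.measurable_rnDeriv _ _), lintegral_indicator_one hR,
        Measure.setLIntegral_rnDeriv hac, Measure.map_apply ht hC,
        Measure.restrict_apply hR, Measure.restrict_apply (ht hC), Set.inter_comm]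
  | compl E hE ih =>
    obtain ⟨g, hg, h⟩ := ih
    refine ⟨fun p => 1 - g p, measurable_const.sub hg, fun a C hC => ?_⟩
    have hga : Measurable fun z => g (a, z) := hg.comp measurable_prodMk_left
    have hEa : Measurable fun ω => E.indicator (1 : A × Ω → ℝ≥0∞) (a, ω) :=
      (measurable_one.indicator hE).comp measurable_prodMk_left
    -- Subtraction in `ℝ≥0∞` is truncated, so `1 - g` integrates correctly only once `g ≤ 1` almost
    -- everywhere.
    have hle : ∀ᵐ z ∂(P.map t), g (a, z) ≤ 1 := by
      refine ae_le_of_forall_setLIntegral_le_of_sigmaFinite hga fun D hD _ => ?_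
      rw [← h a D hD, setLIntegral_one, Measure.map_apply ht hD, ← setLIntegral_one]
      exact lintegral_mono fun ω => Set.indicator_le_self' (by simp) _
    have h1 : ∀ ω, Eᶜ.indicator (1 : A × Ω → ℝ≥0∞) (a, ω)
        = 1 - E.indicator (1 : A × Ω → ℝ≥0∞) (a, ω) := by
      intro ω; by_cases h : (a, ω) ∈ E <;> simp [h]
    simp_rw [h1]
    rw [lintegral_sub hEa, lintegral_sub hga, h a C hC, setLIntegral_one, setLIntegral_one,
      Measure.map_apply ht hC]
    · rw [← h a C hC]
      refine ((lintegral_mono (g := 1) fun ω => ?_).trans_lt ?_).ne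
      · exact Set.indicator_le_self' (by simp) _
      · simp
    · exact ae_restrict_of_ae hle
    · refine ((lintegral_mono (g := 1) fun ω => ?_).trans_lt ?_).ne
      · exact Set.indicator_le_self' (by simp) _
      · simp
    · exact ae_of_all _ fun ω => Set.indicator_le_self' (by simp) _
  | iUnion E hd hE ih =>
    choose g hg h using ih
    refine ⟨fun p => ∑' n, g n p, Measurable.tsum hg, fun a C hC => ?_⟩
    have h1 : ∀ ω, (⋃ n, E n).indicator (1 : A × Ω → ℝ≥0∞) (a, ω)
        = ∑' n, (E n).indicator (1 : A × Ω → ℝ≥0∞) (a, ω) := fun ω => by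
      have hm := measure_iUnion (μ := Measure.dirac (a, ω)) hd hE
      simpa only [Measure.dirac_apply' _ (MeasurableSet.iUnion hE),
        fun n => Measure.dirac_apply' (a, ω) (hE n)] using hm
    simp_rw [h1]
    have hEa : ∀ n, Measurable fun ω => (E n).indicator (1 : A × Ω → ℝ≥0∞) (a, ω) := fun n =>
      (measurable_one.indicator (hE n)).comp measurable_prodMk_left
    have hga : ∀ n, Measurable fun z => g n (a, z) := fun n => (hg n).comp measurable_prodMk_left
    rw [lintegral_tsum fun n => (hEa n).aemeasurable,
      lintegral_tsum fun n => (hga n).aemeasurable]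
    exact tsum_congr fun n => h n a C hC

/-- For a jointly measurable `f`, the images under `t` of the measures `f (a, ·) P` have a jointly
measurable density with respect to the image of `P`; no countability assumption is needed. -/
theorem exists_density_map (P : Measure Ω) [IsProbabilityMeasure P] {t : Ω → T}
    (ht : Measurable t) {f : A × Ω → ℝ≥0∞} (hf : Measurable f) :
    ∃ g : A × T → ℝ≥0∞, Measurable g ∧ ∀ a, ∀ C, MeasurableSet C →
      ∫⁻ ω in t ⁻¹' C, f (a, ω) ∂P = ∫⁻ z in C, g (a, z) ∂(P.map t) := by
  have hPt : IsProbabilityMeasure (P.map t) := Measure.isProbabilityMeasure_map ht.aemeasurable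
  refine Measurable.ennreal_induction (fun c E hE => ?_) (fun f f' _ hf hf' ih ih' => ?_)
    (fun f hf hmono ih => ?_) hf
  · obtain ⟨g, hg, h⟩ := exists_density_map_set P ht hE
    refine ⟨fun p => c * g p, hg.const_mul c, fun a C hC => ?_⟩
    have h1 : ∀ p : A × Ω, E.indicator (fun _ => c) p = c * E.indicator 1 p := by
      intro p; by_cases hp : p ∈ E <;> simp [hp]
    simp_rw [h1]
    rw [lintegral_const_mul _ (measurable_fiber (measurable_one.indicator hE) a),
      lintegral_const_mul _ (measurable_fiber hg a), h a C hC]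
  · obtain ⟨g, hg, h⟩ := ih
    obtain ⟨g', hg', h'⟩ := ih'
    refine ⟨g + g', hg.add hg', fun a C hC => ?_⟩
    simp only [Pi.add_apply]
    rw [lintegral_add_left (measurable_fiber hf a),
      lintegral_add_left (measurable_fiber hg a), h a C hC, h' a C hC]
  · choose g hg h using ih
    refine ⟨fun p => ⨆ n, g n p, Measurable.iSup hg, fun a C hC => ?_⟩
    have hga : ∀ n, Measurable fun z => g n (a, z) := fun n => measurable_fiber (hg n) a
    dsimp only
    -- The densities `g n` were chosen independently, so for each `a` they increase only almost
    -- everywhere.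
    rw [lintegral_iSup (fun n => measurable_fiber (hf n) a)
      (fun n m hnm ω => hmono hnm (a, ω)), lintegral_iSup_ae hga]
    · exact iSup_congr fun n => h n a C hC
    · intro n
      refine ae_restrict_of_ae (ae_le_of_forall_setLIntegral_le_of_sigmaFinite (hga n)
        fun D hD _ => ?_)
      rw [← h n a D hD, ← h (n + 1) a D hD]
      exact lintegral_mono fun ω => hmono n.le_succ (a, ω)

end Densities

/-! ### Lifting the density of `(U, X)` to the whole source -/

section AbsolutelyContinuousPart

variable {Ω X U : Type*} [MeasurableSpace Ω] [MeasurableSpace X] [MeasurableSpace U]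

/-- If `U` depends on `ω` only through `φ ω`, then the density of the absolutely continuous part of
the law of `(U, φ ω)` is also the density of the law of `(U, ω)`, off the set carrying the
singular part of the former. -/
theorem withDensity_rnDeriv_comp (P : Measure Ω) [IsProbabilityMeasure P] {φ : Ω → X}
    (hφ : Measurable φ) (Q : Kernel X U) [IsMarkovKernel Q] (PU : Measure U)
    [IsProbabilityMeasure PU] (ν : Measure (U × X))
    (hν : ν = (P.map φ ⊗ₘ Q).map Prod.swap) :
    (PU.prod P).withDensity (fun p => ν.rnDeriv (PU.prod (P.map φ)) (p.1, φ p.2))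
      = ((P ⊗ₘ Q.comap φ hφ).map Prod.swap).restrict
        ((Prod.map id φ) ⁻¹' regularSet ν (PU.prod (P.map φ))) := by
  have hPφ : IsProbabilityMeasure (P.map φ) := Measure.isProbabilityMeasure_map hφ.aemeasurable
  have hνp : IsProbabilityMeasure ν := by
    rw [hν]; exact Measure.isProbabilityMeasure_map measurable_swap.aemeasurable
  have hΘ : IsProbabilityMeasure ((P ⊗ₘ Q.comap φ hφ).map Prod.swap) :=
    Measure.isProbabilityMeasure_map measurable_swap.aemeasurable
  set π := PU.prod (P.map φ) with hπ
  set G := regularSet ν π with hG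
  have hGm : MeasurableSet G := measurableSet_regularSet ν π
  have hidφ : Measurable (Prod.map id φ : U × Ω → U × X) := measurable_id.prodMap hφ
  have hρ : Measurable (ν.rnDeriv π) := Measure.measurable_rnDeriv ν π
  symm
  refine Measure.ext_prod fun {B} {A} hB hA => ?_
  have hac : (P.restrict A).map φ ≪ P.map φ :=
    (Measure.absolutelyContinuous_of_le Measure.restrict_le_self).map hφ
  -- `h` is a version of the conditional probability of `A` given `φ`. Since `U` sees `ω` only
  -- through `φ ω`, both measures of the rectangle `B ×ˢ A` become the same integral of `h` over the
  -- image of `P`.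
  set h := ((P.restrict A).map φ).rnDeriv (P.map φ) with hh
  have hhm : Measurable h := Measure.measurable_rnDeriv _ _
  have hint : ∀ k : X → ℝ≥0∞, Measurable k →
      ∫⁻ ω in A, k (φ ω) ∂P = ∫⁻ x, h x * k x ∂(P.map φ) := by
    intro k hk
    rw [← lintegral_map hk hφ, ← Measure.withDensity_rnDeriv_eq _ _ hac,
      lintegral_withDensity_eq_lintegral_mul _ (Measure.measurable_rnDeriv _ _) hk]
    rfl
  have hsec : ∀ x, MeasurableSet {u | u ∈ B ∧ (u, x) ∈ G} := fun x =>
    hB.inter (measurable_prodMk_right hGm)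
  have hQ : Measurable fun x => Q x {u | u ∈ B ∧ (u, x) ∈ G} := by
    have : MeasurableSet {p : X × U | p.2 ∈ B ∧ (p.2, p.1) ∈ G} :=
      (measurable_snd hB).inter (measurable_swap hGm)
    exact Kernel.measurable_kernel_prodMk_left this
  trans ∫⁻ x, h x * Q x {u | u ∈ B ∧ (u, x) ∈ G} ∂(P.map φ)
  · rw [Measure.restrict_apply (hB.prod hA),
      Measure.map_apply measurable_swap ((hB.prod hA).inter (hidφ hGm)),
      Measure.compProd_apply (measurable_swap ((hB.prod hA).inter (hidφ hGm))), ← hint _ hQ,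
      ← lintegral_indicator hA]
    refine lintegral_congr fun ω => ?_
    by_cases hω : ω ∈ A
    · simp only [hω, Set.indicator_of_mem, Kernel.comap_apply]
      congr 1
      ext u
      simp [hω]
    · simp only [hω, not_false_eq_true, Set.indicator_of_notMem]
      convert measure_empty (μ := (Q.comap φ hφ) ω)
      ext u
      simp [hω]
  · have hBm : Measurable (B.indicator (1 : U → ℝ≥0∞)) := measurable_one.indicator hB
    have hmeas : Measurable fun p : U × X => h p.2 * B.indicator (1 : U → ℝ≥0∞) p.1 :=
      (hhm.comp measurable_snd).mul (hBm.comp measurable_fst)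
    have e1 : ∫⁻ p, h p.2 * B.indicator (1 : U → ℝ≥0∞) p.1 ∂(ν.restrict G)
        = ∫⁻ x, h x * Q x {u | u ∈ B ∧ (u, x) ∈ G} ∂(P.map φ) := by
      rw [← lintegral_indicator hGm]
      conv_lhs => rw [hν]
      rw [lintegral_map (hmeas.indicator hGm) measurable_swap,
        Measure.lintegral_compProd (f := fun a : X × U => G.indicator
          (fun p => h p.2 * B.indicator (1 : U → ℝ≥0∞) p.1) a.swap)
          ((hmeas.indicator hGm).comp measurable_swap)]
      refine lintegral_congr fun x => ?_
      rw [← lintegral_indicator_one (hsec x), ← lintegral_const_mul _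
        (measurable_one.indicator (hsec x))]
      refine lintegral_congr fun u => ?_
      by_cases h1 : u ∈ B <;> by_cases h2 : (u, x) ∈ G <;> simp [h1, h2]
    rw [← e1, hG, restrict_regularSet,
      lintegral_withDensity_eq_lintegral_mul _ hρ hmeas, hπ,
      lintegral_prod _ (hρ.mul hmeas).aemeasurable, withDensity_apply _ (hB.prod hA),
      ← Measure.prod_restrict,
      ← hπ, lintegral_prod (fun p : U × Ω => ν.rnDeriv π (p.1, φ p.2))
        (hρ.comp hidφ).aemeasurable, ← lintegral_indicator hB]
    refine lintegral_congr fun u => ?_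
    have := hint (fun x => ν.rnDeriv π (u, x)) (measurable_fiber hρ u)
    by_cases hu : u ∈ B
    · simp only [hu, Set.indicator_of_mem, Pi.mul_apply, Pi.one_apply, mul_one]
      rw [this]
      exact lintegral_congr fun x => mul_comm _ _
    · simp [hu]

theorem map_compProd_comap (P : Measure Ω) [IsProbabilityMeasure P] {φ : Ω → X}
    (hφ : Measurable φ) (Q : Kernel X U) [IsMarkovKernel Q] :
    (P ⊗ₘ Q.comap φ hφ).map (fun ω => (ω.2, φ ω.1)) = (P.map φ ⊗ₘ Q).map Prod.swap := by
  have hm : Measurable fun ω : Ω × U => (ω.2, φ ω.1) := by fun_prop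
  ext s hs
  rw [Measure.map_apply hm hs, Measure.map_apply measurable_swap hs,
    Measure.compProd_apply (hm hs), Measure.compProd_apply (measurable_swap hs),
    lintegral_map (Kernel.measurable_kernel_prodMk_left (measurable_swap hs)) hφ]
  rfl

end AbsolutelyContinuousPart

/-! ### Laws induced by the test channel -/

section Laws

variable {X Y Z U : Type*} [MeasurableSpace X] [MeasurableSpace Y] [MeasurableSpace Z]
  [MeasurableSpace U] {T : Type*} [MeasurableSpace T] {t : X × Y × Z → T}
  (P : Measure (X × Y × Z)) (Q : Kernel X U)

/-- The law of `(U, (X, Y, Z))`. -/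
noncomputable def jointLaw : Measure (U × X × Y × Z) := (testLaw P Q).map Prod.swap

/-- The law of `U`. -/
noncomputable def lawU : Measure U := (jointLaw P Q).fst

/-- The likelihood as a function of the codeword and of the source output. -/
noncomputable def sourceLikelihood (p : U × X × Y × Z) : ℝ≥0∞ :=
  ENNReal.ofReal (likelihood P Q p.1 p.2.1)

theorem lawUX_eq : lawUX P Q = (jointLaw P Q).map (Prod.map id fun ω => ω.1) := by
  rw [jointLaw, Measure.map_map (measurable_id.prodMap measurable_fst) measurable_swap]; rfl

theorem lawUY_eq : lawUY P Q = (jointLaw P Q).map (Prod.map id fun ω => ω.2.1) := by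
  rw [jointLaw, Measure.map_map (measurable_id.prodMap (by fun_prop)) measurable_swap]; rfl

theorem lawUZ_eq : lawUZ P Q = (jointLaw P Q).map (Prod.map id fun ω => ω.2.2) := by
  rw [jointLaw, Measure.map_map (measurable_id.prodMap (by fun_prop)) measurable_swap]; rfl

theorem fst_map_jointLaw (ht : Measurable t) :
    ((jointLaw P Q).map (Prod.map id t)).fst = lawU P Q := by
  rw [lawU, Measure.fst, Measure.map_map measurable_fst (measurable_id.prodMap ht)]; rfl

theorem measurable_likelihood : Measurable fun p : U × X => likelihood P Q p.1 p.2 :=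
  (Measure.measurable_rnDeriv _ _).ennreal_toReal

theorem measurable_sourceLikelihood : Measurable (sourceLikelihood P Q) :=
  ((measurable_likelihood P Q).comp
    (measurable_id.prodMap measurable_fst : Measurable (Prod.map id (fun ω : X × Y × Z => ω.1)
      : U × X × Y × Z → U × X))).ennreal_ofReal

variable [IsProbabilityMeasure P] [IsMarkovKernel Q]

instance : IsProbabilityMeasure (testLaw P Q) := by unfold testLaw; infer_instance

instance : IsProbabilityMeasure (jointLaw P Q) :=
  Measure.isProbabilityMeasure_map measurable_swap.aemeasurable

instance : IsProbabilityMeasure (lawU P Q) := by unfold lawU; infer_instance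

theorem jointLaw_snd : (jointLaw P Q).snd = P := by
  rw [jointLaw, Measure.snd_map_swap, testLaw, Measure.fst_compProd]

theorem snd_map_jointLaw (ht : Measurable t) :
    ((jointLaw P Q).map (Prod.map id t)).snd = P.map t := by
  conv_rhs => rw [← jointLaw_snd P Q]
  rw [Measure.snd, Measure.map_map measurable_snd (measurable_id.prodMap ht), Measure.snd,
    Measure.map_map ht measurable_snd]; rfl

theorem isProbabilityMeasure_map_jointLaw (ht : Measurable t) :
    IsProbabilityMeasure ((jointLaw P Q).map (Prod.map id t)) :=
  Measure.isProbabilityMeasure_map (measurable_id.prodMap ht).aemeasurable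

theorem map_prod_lawU (ht : Measurable t) :
    ((lawU P Q).prod P).map (Prod.map id t) = (lawU P Q).prod (P.map t) := by
  rw [← Measure.map_prod_map _ _ measurable_id ht, Measure.map_id]

/-- Passing to real values changes the derivative only where it is infinite, a null set. -/
theorem likelihood_ae_eq : (fun p : U × X => ENNReal.ofReal (likelihood P Q p.1 p.2))
    =ᵐ[(lawU P Q).prod (P.map fun ω => ω.1)]
      (lawUX P Q).rnDeriv ((lawU P Q).prod (P.map fun ω => ω.1)) := by
  have hp := isProbabilityMeasure_map_jointLaw P Q
    (measurable_fst : Measurable fun ω : X × Y × Z => ω.1)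
  have h1 := fst_map_jointLaw P Q (measurable_fst : Measurable fun ω : X × Y × Z => ω.1)
  have h2 := snd_map_jointLaw P Q (measurable_fst : Measurable fun ω : X × Y × Z => ω.1)
  rw [← lawUX_eq] at hp h1 h2
  have hprob : IsProbabilityMeasure (P.map fun ω => ω.1) := by rw [← h2]; infer_instance
  filter_upwards [Measure.rnDeriv_lt_top (lawUX P Q) ((lawU P Q).prod (P.map fun ω => ω.1))]
    with p hp
  rw [likelihood, h1, h2, ENNReal.ofReal_toReal hp.ne]

/-- The density `sourceLikelihood` describes the part of the law of `(U, (X, Y, Z))` that lies off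
the set carrying the singular part of the law of `(U, X)`. -/
theorem withDensity_sourceLikelihood_le :
    ((lawU P Q).prod P).withDensity (sourceLikelihood P Q) ≤ jointLaw P Q := by
  have hprob : IsProbabilityMeasure (P.map fun ω => ω.1) :=
    Measure.isProbabilityMeasure_map measurable_fst.aemeasurable
  have hν : lawUX P Q = (P.map (fun ω => ω.1) ⊗ₘ Q).map Prod.swap :=
    map_compProd_comap P measurable_fst Q
  have key := withDensity_rnDeriv_comp P (measurable_fst : Measurable fun ω : X × Y × Z => ω.1) Q
    (lawU P Q) (lawUX P Q) hν
  have hae : sourceLikelihood P Q =ᵐ[(lawU P Q).prod P] fun p =>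
      (lawUX P Q).rnDeriv ((lawU P Q).prod (P.map fun ω => ω.1)) (p.1, p.2.1) := by
    have hm : Measurable (Prod.map id (fun ω : X × Y × Z => ω.1) : U × X × Y × Z → U × X) :=
      measurable_id.prodMap measurable_fst
    have := likelihood_ae_eq P Q
    rw [← map_prod_lawU P Q measurable_fst] at this
    have := ae_of_ae_map hm.aemeasurable this
    rw [map_prod_lawU P Q measurable_fst] at this
    exact this
  rw [withDensity_congr_ae hae, key]
  exact Measure.restrict_le_self

end Laws

/-! ### Soft covering -/

section SoftCovering

variable {U Z I ι : Type*} [Fintype ι] {e : ι → I}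

/-- The mean of `g` over the codewords of the codebook `c` with index in the image of `e`. -/
noncomputable def codeAverage (e : ι → I) (g : U → ℝ≥0∞) (c : I → U) : ℝ≥0∞ :=
  (∑ i, g (c (e i))) / Fintype.card ι

theorem codeAverage_mono (e : ι → I) {g g' : U → ℝ≥0∞} (h : ∀ u, g u ≤ g' u) (c : I → U) :
    codeAverage e g c ≤ codeAverage e g' c :=
  ENNReal.div_le_div_right (Finset.sum_le_sum fun _ _ => h _) _

variable [MeasurableSpace U] [MeasurableSpace Z]

theorem measurable_codeAverage (e : ι → I) {g : U → ℝ≥0∞} (hg : Measurable g) :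
    Measurable (codeAverage e g) :=
  (Finset.measurable_sum _ fun i _ => hg.comp (measurable_pi_apply (e i))).div_const _

theorem measurable_codeAverage_prod (e : ι → I) {g : U × Z → ℝ≥0∞} (hg : Measurable g) :
    Measurable fun p : (I → U) × Z => codeAverage e (fun u => g (u, p.2)) p.1 :=
  (Finset.measurable_sum _ fun i _ => hg.comp
    (((measurable_pi_apply (e i)).comp measurable_fst).prodMk measurable_snd)).div_const _

variable [Fintype I] (μ : Measure U) [IsProbabilityMeasure μ]

theorem lintegral_eval (i : I) {g : U → ℝ≥0∞} (hg : Measurable g) :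
    ∫⁻ c, g (c i) ∂(Measure.pi fun _ : I => μ) = ∫⁻ u, g u ∂μ :=
  (measurePreserving_eval (fun _ : I => μ) i).lintegral_comp hg

theorem lintegral_codeAverage [Nonempty ι] (e : ι → I) {g : U → ℝ≥0∞} (hg : Measurable g) :
    ∫⁻ c, codeAverage e g c ∂(Measure.pi fun _ : I => μ) = ∫⁻ u, g u ∂μ := by
  have hgi : ∀ i, Measurable fun c : I → U => g (c (e i)) := fun i =>
    hg.comp (measurable_pi_apply (e i))
  simp only [codeAverage, div_eq_mul_inv]
  rw [lintegral_mul_const _ (Finset.measurable_sum _ fun i _ => hgi i),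
    lintegral_finsetSum _ fun i _ => hgi i]
  simp only [lintegral_eval μ _ hg, Finset.sum_const, Finset.card_univ, nsmul_eq_mul]
  rw [mul_comm, ← mul_assoc, ENNReal.inv_mul_cancel, one_mul]
  · exact_mod_cast Fintype.card_ne_zero
  · exact ENNReal.natCast_ne_top _

/-- The second moment estimate behind soft covering, for real bounded functions. -/
theorem lintegral_ofReal_sub_average_le [Nonempty ι] (he : Function.Injective e) {h : U → ℝ}
    (hm : Measurable h) {C : ℝ} (hC : 0 < C) (h0 : ∀ u, 0 ≤ h u) (hle : ∀ u, h u ≤ C)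
    (h1 : ∫ u, h u ∂μ ≤ 1) :
    ∫⁻ c, ENNReal.ofReal (∫ u, h u ∂μ - (∑ i, h (c (e i))) / Fintype.card ι)
        ∂(Measure.pi fun _ : I => μ)
      ≤ ENNReal.ofReal (1 / 2 * √(C / Fintype.card ι)) := by
  set n : ℝ := (Fintype.card ι : ℝ) with hn
  have hn0 : 0 < n := by rw [hn]; exact_mod_cast Fintype.card_pos
  set m := ∫ u, h u ∂μ with hmdef
  -- `s` bounds the standard deviation of the average; it is the optimal scale in the quadratic
  -- bound on the positive part below.
  set s := √(C / n) with hs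
  have hs0 : 0 < s := Real.sqrt_pos.2 (by positivity)
  have hs2 : s * s = C / n := Real.mul_self_sqrt (by positivity)
  set Pc := Measure.pi fun _ : I => μ with hP
  have hb : ∀ᵐ u ∂μ, h u ∈ Set.Icc 0 C := ae_of_all _ fun u => ⟨h0 u, hle u⟩
  have hLp : MemLp h 2 μ := memLp_of_bounded hb hm.aestronglyMeasurable 2
  have hLpe : ∀ i : I, MemLp (fun c : I → U => h (c i)) 2 Pc := fun i =>
    hLp.comp_measurePreserving (measurePreserving_eval (fun _ : I => μ) i)
  have hinte : ∀ i : I, ∫ c, h (c i) ∂Pc = m := fun i =>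
    integral_comp_eval (μ := fun _ : I => μ) hm.aestronglyMeasurable
  -- A variable in `[0, C]` with mean `m ≤ 1` has variance at most `m * (C - m) ≤ C`: linear in `C`,
  -- not quadratic.
  have hvare : ∀ i : I, Var[fun c : I → U => h (c i); Pc] ≤ C := by
    intro i
    have hm0 : 0 ≤ m := integral_nonneg h0
    have := variance_le_sub_mul_sub (μ := Pc) (X := fun c : I → U => h (c i)) (a := 0) (b := C)
      (ae_of_all _ fun c => ⟨h0 _, hle _⟩) (hm.comp (measurable_pi_apply i)).aemeasurable
    rw [hinte] at this
    nlinarith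
  let A : (I → U) → ℝ := ∑ i : ι, fun c => h (c (e i))
  have hA : ∀ c, A c = ∑ i, h (c (e i)) := fun c => Finset.sum_apply _ _ _
  have hALp : MemLp A 2 Pc := memLp_finsetSum' _ fun i _ => hLpe (e i)
  have hAvar : Var[A; Pc] ≤ n * C := by
    rw [IndepFun.variance_sum (fun i _ => hLpe (e i))]
    · calc ∑ i : ι, Var[fun c : I → U => h (c (e i)); Pc] ≤ ∑ i : ι, C :=
          Finset.sum_le_sum fun i _ => hvare _
        _ = n * C := by simp [hn]
    · intro i _ j _ hij
      exact (iIndepFun_pi (μ := fun _ : I => μ) (X := fun _ => h)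
        fun _ => hm.aemeasurable).indepFun (he.ne hij)
  have hAint : ∫ c, A c ∂Pc = n * m := by
    simp only [hA]
    rw [integral_finsetSum _ fun i _ => (hLpe (e i)).integrable one_le_two]
    simp [hinte, hn]
  let D : (I → U) → ℝ := fun c => m - A c / n
  have hDLp : MemLp D 2 Pc := (memLp_const m).sub (hALp.mul_const n⁻¹)
  have hDint : ∫ c, D c ∂Pc = 0 := by
    simp only [D]
    rw [integral_sub (integrable_const _) ((hALp.integrable one_le_two).div_const n),
      integral_div, hAint]
    simp; field_simp; simp
  have hDsq : ∫ c, D c ^ 2 ∂Pc ≤ C / n := by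
    have e1 : ∫ c, D c ^ 2 ∂Pc = Var[D; Pc] := by
      rw [variance_of_integral_eq_zero hDLp.aestronglyMeasurable.aemeasurable hDint]
    have e2 : Var[D; Pc] = Var[A; Pc] * n⁻¹ ^ 2 := by
      simp only [D, div_eq_mul_inv]
      rw [variance_const_sub (hALp.aestronglyMeasurable.mul_const n⁻¹), variance_mul_const]
    rw [e1, e2]
    calc Var[A; Pc] * n⁻¹ ^ 2 ≤ (n * C) * n⁻¹ ^ 2 := by gcongr
      _ = C / n := by field_simp
  -- The positive part is `(D + |D|) / 2`, with `|D| ≤ (D ^ 2 / s + s) / 2`. As `D` has mean zero,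
  -- only the second half contributes; this is the source of the factor `1 / 2`.
  have hpt : ∀ c, ENNReal.ofReal (m - (∑ i, h (c (e i))) / n)
      ≤ ENNReal.ofReal (D c / 2 + (D c ^ 2 / s + s) / 4) := by
    intro c
    rw [← hA c]
    refine ENNReal.ofReal_le_ofReal ?_
    have : 0 ≤ (D c - s) ^ 2 / s := by positivity
    have e : (D c - s) ^ 2 / s = D c ^ 2 / s - 2 * D c + s := by field_simp; ring
    change D c ≤ _
    linarith
  have hnn : ∀ c, 0 ≤ D c / 2 + (D c ^ 2 / s + s) / 4 := by
    intro c
    have : 0 ≤ (D c + s) ^ 2 / s := by positivity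
    have e : (D c + s) ^ 2 / s = D c ^ 2 / s + 2 * D c + s := by field_simp; ring
    linarith
  have hDi : Integrable D Pc := hDLp.integrable one_le_two
  have hD2i : Integrable (fun c => D c ^ 2) Pc := hDLp.integrable_sq
  have hi2 : Integrable (fun c => (D c ^ 2 / s + s) / 4) Pc :=
    ((hD2i.div_const s).add (integrable_const s)).div_const 4
  refine (lintegral_mono hpt).trans ?_
  have hi : Integrable (fun c => D c / 2 + (D c ^ 2 / s + s) / 4) Pc :=
    (hDi.div_const 2).add hi2
  rw [← ofReal_integral_eq_lintegral_ofReal hi (ae_of_all _ hnn)]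
  refine ENNReal.ofReal_le_ofReal ?_
  rw [integral_add (hDi.div_const 2) hi2, integral_div, hDint, integral_div,
    integral_add (hD2i.div_const s) (integrable_const s), integral_div]
  have : (∫ c, D c ^ 2 ∂Pc) / s ≤ s := by
    rw [div_le_iff₀ hs0, hs2]; exact hDsq
  simp only [zero_div, zero_add, integral_const, probReal_univ, smul_eq_mul, one_mul]
  linarith

/-- The deficit splits into the deterministic shortfall of the mean below one and the downward
fluctuation of the average around its mean. -/
theorem lintegral_one_sub_codeAverage_le [Nonempty ι] (he : Function.Injective e) {g : U → ℝ≥0∞}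
    (hg : Measurable g) {C : ℝ} (hC : 0 < C) (hle : ∀ u, g u ≤ ENNReal.ofReal C)
    (h1 : ∫⁻ u, g u ∂μ ≤ 1) :
    ∫⁻ c, (1 - codeAverage e g c) ∂(Measure.pi fun _ : I => μ)
      ≤ (1 - ∫⁻ u, g u ∂μ) + ENNReal.ofReal (1 / 2 * √(C / Fintype.card ι)) := by
  have htop : ∀ u, g u ≠ ∞ := fun u => ((hle u).trans_lt ENNReal.ofReal_lt_top).ne
  have hint : ∫ u, (g u).toReal ∂μ = (∫⁻ u, g u ∂μ).toReal :=
    integral_toReal hg.aemeasurable (ae_of_all _ fun u => (htop u).lt_top)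
  have hfin : ∫⁻ u, g u ∂μ ≠ ∞ := (h1.trans_lt ENNReal.one_lt_top).ne
  have key := lintegral_ofReal_sub_average_le (e := e) μ he hg.ennreal_toReal hC
    (fun u => ENNReal.toReal_nonneg)
    (fun u => (ENNReal.toReal_le_of_le_ofReal hC.le (hle u)))
    (by rw [hint]; exact ENNReal.toReal_le_of_le_ofReal zero_le_one (by simpa using h1))
  have hpt : ∀ c : I → U, 1 - codeAverage e g c ≤ (1 - ∫⁻ u, g u ∂μ)
      + ENNReal.ofReal (∫ u, (g u).toReal ∂μ
        - (∑ i, (g (c (e i))).toReal) / Fintype.card ι) := by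
    intro c
    have ha : codeAverage e g c
        = ENNReal.ofReal ((∑ i, (g (c (e i))).toReal) / Fintype.card ι) := by
      rw [ENNReal.ofReal_div_of_pos (by exact_mod_cast Fintype.card_pos),
        ENNReal.ofReal_sum_of_nonneg fun _ _ => ENNReal.toReal_nonneg, ENNReal.ofReal_natCast]
      simp [codeAverage, ENNReal.ofReal_toReal (htop _)]
    rw [hint, ENNReal.ofReal_sub _ (by positivity), ← ha, ENNReal.ofReal_toReal hfin]
    exact tsub_le_tsub_add_tsub
  refine (lintegral_mono hpt).trans ?_
  rw [lintegral_add_left measurable_const, lintegral_const, measure_univ, mul_one]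
  exact add_le_add_right key _

/-- The soft covering bound, integrated over the output: on average over the codebook, the mean of
`g` over the codewords is not much below `1`. -/
theorem lintegral_lintegral_one_sub_codeAverage_le [Nonempty ι] (he : Function.Injective e)
    (π : Measure Z) [IsProbabilityMeasure π] {g : U × Z → ℝ≥0∞} (hg : Measurable g)
    (h1 : ∀ᵐ z ∂π, ∫⁻ u, g (u, z) ∂μ ≤ 1) {C : ℝ} (hC : 0 < C) :
    ∫⁻ c, ∫⁻ z, (1 - codeAverage e (fun u => g (u, z)) c) ∂π ∂(Measure.pi fun _ : I => μ)
      ≤ (1 - ((μ.prod π).withDensity g) {p | g p ≤ ENNReal.ofReal C})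
        + ENNReal.ofReal (1 / 2 * √(C / Fintype.card ι)) := by
  -- Truncating `g` only increases the deficit `1 - codeAverage`, so the bounded case applies. The
  -- discarded mass reappears as the shortfall of the mean.
  set E : Set (U × Z) := {p | g p ≤ ENNReal.ofReal C} with hE
  have hEm : MeasurableSet E := measurableSet_le hg measurable_const
  set g' : U × Z → ℝ≥0∞ := E.indicator g with hg'
  have hg'm : Measurable g' := hg.indicator hEm
  have hle : ∀ p, g' p ≤ g p := fun p => Set.indicator_le_self' (by simp) p
  have hbound : ∀ p, g' p ≤ ENNReal.ofReal C := by
    intro p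
    by_cases hp : p ∈ E
    · rw [hg', Set.indicator_of_mem hp]; exact hp
    · simp [hg', hp]
  have hg'z : ∀ z, Measurable fun u => g' (u, z) := fun z => hg'm.comp measurable_prodMk_right
  have hmz : Measurable fun z => ∫⁻ u, g' (u, z) ∂μ := hg'm.lintegral_prod_left'
  have h1' : ∀ᵐ z ∂π, ∫⁻ u, g' (u, z) ∂μ ≤ 1 := by
    filter_upwards [h1] with z hz
    exact (lintegral_mono fun u => hle _).trans hz
  have hmass : ∫⁻ z, ∫⁻ u, g' (u, z) ∂μ ∂π = ((μ.prod π).withDensity g) E := by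
    rw [withDensity_apply _ hEm, ← lintegral_indicator hEm,
      lintegral_prod_symm _ hg'm.aemeasurable]
  have hfin : ∫⁻ z, ∫⁻ u, g' (u, z) ∂μ ∂π ≠ ∞ :=
    ((lintegral_mono_ae h1').trans_lt (by simp)).ne
  rw [lintegral_lintegral_swap
    (measurable_const.sub (measurable_codeAverage_prod e hg)).aemeasurable]
  calc ∫⁻ z, ∫⁻ c, (1 - codeAverage e (fun u => g (u, z)) c) ∂(Measure.pi fun _ : I => μ) ∂π
      ≤ ∫⁻ z, ((1 - ∫⁻ u, g' (u, z) ∂μ) + ENNReal.ofReal (1 / 2 * √(C / Fintype.card ι))) ∂π := by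
        refine lintegral_mono_ae ?_
        filter_upwards [h1'] with z hz
        refine le_trans (lintegral_mono fun c => ?_)
          (lintegral_one_sub_codeAverage_le μ he (hg'z z) hC (fun u => hbound _) hz)
        exact tsub_le_tsub_left (codeAverage_mono e (fun u => hle _) c) 1
    _ = (1 - ((μ.prod π).withDensity g) E) + ENNReal.ofReal (1 / 2 * √(C / Fintype.card ι)) := by
        rw [lintegral_add_right _ measurable_const, lintegral_sub hmz hfin h1', hmass]
        simp

/-- Upward deviations of the mean are no larger on average than downward deviations. -/
theorem lintegral_lintegral_codeAverage_sub_one_le [Nonempty ι] (e : ι → I)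
    (π : Measure Z) [IsProbabilityMeasure π] {g : U × Z → ℝ≥0∞} (hg : Measurable g)
    (h1 : ∀ᵐ z ∂π, ∫⁻ u, g (u, z) ∂μ ≤ 1) :
    ∫⁻ c, ∫⁻ z, (codeAverage e (fun u => g (u, z)) c - 1) ∂π ∂(Measure.pi fun _ : I => μ)
      ≤ ∫⁻ c, ∫⁻ z, (1 - codeAverage e (fun u => g (u, z)) c) ∂π
        ∂(Measure.pi fun _ : I => μ) := by
  have hm := measurable_codeAverage_prod (Z := Z) e hg
  have hm' : Measurable fun p : (I → U) × Z => 1 - codeAverage e (fun u => g (u, p.2)) p.1 :=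
    measurable_const.sub hm
  rw [lintegral_lintegral_swap (hm.sub measurable_const).aemeasurable,
    lintegral_lintegral_swap (μ := Measure.pi fun _ : I => μ) (ν := π)
      (f := fun (c : I → U) z => 1 - codeAverage e (fun u => g (u, z)) c) hm'.aemeasurable]
  refine lintegral_mono_ae ?_
  filter_upwards [h1] with z hz
  have hgz : Measurable fun u => g (u, z) := hg.comp measurable_prodMk_right
  have ha := measurable_codeAverage (I := I) e hgz
  refine (ENNReal.add_le_add_iff_right ENNReal.one_ne_top).1 ?_
  -- Excess plus one and deficit plus average both equal the maximum of the average and one; the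
  -- average has mean at most one.
  calc ∫⁻ c, (codeAverage e (fun u => g (u, z)) c - 1) ∂(Measure.pi fun _ : I => μ) + 1
      = ∫⁻ c, ((codeAverage e (fun u => g (u, z)) c - 1) + 1) ∂(Measure.pi fun _ : I => μ) := by
        rw [lintegral_add_right _ measurable_const]; simp
    _ = ∫⁻ c, ((1 - codeAverage e (fun u => g (u, z)) c) + codeAverage e (fun u => g (u, z)) c)
          ∂(Measure.pi fun _ : I => μ) := by
        refine lintegral_congr fun c => ?_
        rw [tsub_add_eq_max, tsub_add_eq_max, max_comm]
    _ ≤ _ := by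
        rw [lintegral_add_right _ ha, lintegral_codeAverage μ e hgz]
        exact add_le_add_right hz _

end SoftCovering

theorem le_ofReal_iInf_add {κ : Sort*} [Nonempty κ] {x : κ → ℝ} (h0 : ∀ i, 0 ≤ x i)
    {a d : ℝ≥0∞} (h : ∀ i, a ≤ ENNReal.ofReal (x i) + d) :
    a ≤ ENNReal.ofReal (⨅ i, x i) + d := by
  have h' : ∀ i, a - d ≤ ENNReal.ofReal (x i) := fun i => tsub_le_iff_right.2 (h i)
  have htop : a - d ≠ ∞ :=
    ((h' (Classical.arbitrary κ)).trans_lt ENNReal.ofReal_lt_top).ne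
  rw [← tsub_le_iff_right, ENNReal.le_ofReal_iff_toReal_le htop (Real.iInf_nonneg h0)]
  exact le_ciInf fun i => (ENNReal.le_ofReal_iff_toReal_le htop (h0 i)).1 (h' i)

/-! ### Soft covering in terms of information densities -/

section Covering

variable {U Z I ι : Type*} [MeasurableSpace U] [MeasurableSpace Z] [Fintype I] [Fintype ι]
  {μ : Measure U} {π : Measure Z} [IsProbabilityMeasure μ] [IsProbabilityMeasure π]
  {ν : Measure (U × Z)} {g : U × Z → ℝ≥0∞}

/-- The integral over `u` is the density of a second marginal, which lies below that of `ν`. -/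
theorem lintegral_density_le_one (hg : Measurable g) (hν : ν.snd = π)
    (hle : (μ.prod π).withDensity g ≤ ν) : ∀ᵐ z ∂π, ∫⁻ u, g (u, z) ∂μ ≤ 1 := by
  refine ae_le_of_forall_setLIntegral_le_of_sigmaFinite hg.lintegral_prod_left' fun D hD _ => ?_
  calc ∫⁻ z in D, ∫⁻ u, g (u, z) ∂μ ∂π
      = ((μ.prod π).withDensity g) (Set.univ ×ˢ D) := by
        rw [withDensity_apply _ (MeasurableSet.univ.prod hD), ← Measure.prod_restrict,
          lintegral_prod_symm _ hg.aemeasurable, Measure.restrict_univ]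
    _ ≤ ν (Set.univ ×ˢ D) := hle _
    _ = ∫⁻ _ in D, 1 ∂π := by
        rw [setLIntegral_one, ← hν, Measure.snd_apply hD, Set.univ_prod]

/-- The information density is infinite off the regular set, so its upper tail absorbs the singular
part of `ν` together with the large values of the derivative. -/
theorem one_le_withDensity_add [IsProbabilityMeasure ν] (hμ : ν.fst = μ) (hπ : ν.snd = π)
    (τ : ℝ) : 1 ≤ ((μ.prod π).withDensity (ν.rnDeriv (μ.prod π)))
        {p | ν.rnDeriv (μ.prod π) p ≤ ENNReal.ofReal ((2 : ℝ) ^ τ)}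
      + ν {p | ((τ : ℝ) : EReal) < infoDensity ν p} := by
  subst hμ hπ
  rw [← restrict_regularSet, Measure.restrict_apply
    (measurableSet_le (Measure.measurable_rnDeriv _ _) measurable_const)]
  refine le_trans ?_ (measure_union_le _ _)
  rw [← measure_univ (μ := ν)]
  refine measure_mono fun p _ => ?_
  by_cases hp : τ < infoDensity ν p
  · exact Or.inr hp
  · left
    have hle : likelihoodRatio ν (ν.fst.prod ν.snd) p ≤ ENNReal.ofReal ((2 : ℝ) ^ τ) := by
      rw [← log₂_strictMono.le_iff_le, log₂_two_rpow]
      exact not_lt.1 hp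
    have hreg : p ∈ regularSet ν (ν.fst.prod ν.snd) := by
      by_contra h
      rw [likelihoodRatio_of_notMem h] at hle
      exact absurd hle (by simp)
    rw [likelihoodRatio_of_mem hreg] at hle
    exact ⟨hle, hreg⟩

/-- Soft covering in terms of `coveringBound`, for a density `g` that is smaller than that of the
absolutely continuous part of `ν` by mass at most `d`. -/
theorem lintegral_one_sub_codeAverage_le_coveringBound [Nonempty ι] {e : ι → I}
    (he : Function.Injective e) [IsProbabilityMeasure ν] (hμ : ν.fst = μ) (hπ : ν.snd = π)
    (hg : Measurable g) (hle : (μ.prod π).withDensity g ≤ ν) {d : ℝ≥0∞}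
    (hd : ∀ s, MeasurableSet s → ((μ.prod π).withDensity (ν.rnDeriv (μ.prod π))) s
      ≤ ((μ.prod π).withDensity g) s + d) :
    ∫⁻ c, ∫⁻ z, (1 - codeAverage e (fun u => g (u, z)) c) ∂π ∂(Measure.pi fun _ : I => μ)
      ≤ ENNReal.ofReal (coveringBound ν (Fintype.card ι)) + d := by
  unfold coveringBound
  refine le_ofReal_iInf_add (fun τ => by positivity) fun τ => ?_
  have hρ : Measurable (ν.rnDeriv (μ.prod π)) := Measure.measurable_rnDeriv _ _
  have hC : (0 : ℝ) < (2 : ℝ) ^ (τ : ℝ) := by positivity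
  refine (lintegral_lintegral_one_sub_codeAverage_le μ he π hg
    (lintegral_density_le_one hg hπ hle) hC).trans ?_
  -- Truncation at the level of `g` therefore keeps at least the mass kept by truncation at the
  -- level of the derivative, where the tail bound is available.
  have hgρ : g ≤ᵐ[μ.prod π] ν.rnDeriv (μ.prod π) := by
    refine ae_le_of_forall_setLIntegral_le_of_sigmaFinite hg fun s hs _ => ?_
    rw [← withDensity_apply _ hs, ← withDensity_apply _ hs]
    exact le_withDensity_rnDeriv hle (withDensity_absolutelyContinuous _ _) s
  have hsub : ((μ.prod π).withDensity g)
        {p | ν.rnDeriv (μ.prod π) p ≤ ENNReal.ofReal ((2 : ℝ) ^ (τ : ℝ))}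
      ≤ ((μ.prod π).withDensity g) {p | g p ≤ ENNReal.ofReal ((2 : ℝ) ^ (τ : ℝ))} := by
    refine measure_mono_ae ?_
    filter_upwards [(withDensity_absolutelyContinuous (μ.prod π) g).ae_le hgρ] with p hp hp'
    exact hp.trans hp'
  have h1 := one_le_withDensity_add hμ hπ (τ : ℝ)
  have h2 := hd _ (measurableSet_le hρ
    (measurable_const (a := ENNReal.ofReal ((2 : ℝ) ^ (τ : ℝ)))))
  rw [ENNReal.ofReal_add (by positivity) (by positivity), ofReal_measureReal, add_right_comm]
  refine add_le_add_left (tsub_le_iff_right.2 (h1.trans ?_)) _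
  calc _ ≤ (((μ.prod π).withDensity g) {p | g p ≤ ENNReal.ofReal ((2 : ℝ) ^ (τ : ℝ))} + d)
        + ν {p | ((τ : ℝ) : EReal) < infoDensity ν p} :=
        add_le_add_left (h2.trans (add_le_add_left hsub _)) _
    _ = _ := by ring

end Covering

/-! ### Random coding bound for the decoder -/

section Decoding

variable {U Ω Y I : Type*} [MeasurableSpace U] [MeasurableSpace Ω] [MeasurableSpace Y] [Fintype I]
  {μ : Measure U} {P : Measure Ω} [IsProbabilityMeasure μ] [IsProbabilityMeasure P]
  {Θ : Measure (U × Ω)} [IsProbabilityMeasure Θ] {F : U × Ω → ℝ≥0∞} {t : Ω → Y}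

theorem map_withDensity_absolutelyContinuous (ht : Measurable t) :
    ((μ.prod P).withDensity F).map (Prod.map id t) ≪ μ.prod (P.map t) := by
  have h := (withDensity_absolutelyContinuous (μ.prod P) F).map
    (measurable_id.prodMap ht : Measurable (Prod.map id t : U × Ω → U × Y))
  rwa [← Measure.map_prod_map _ _ measurable_id ht, Measure.map_id] at h

theorem lintegral_pi_mul (i j : I) (hij : i ≠ j) {a b : U → ℝ≥0∞} (ha : Measurable a)
    (hb : Measurable b) :
    ∫⁻ c, a (c i) * b (c j) ∂(Measure.pi fun _ : I => μ) = (∫⁻ u, a u ∂μ) * ∫⁻ u, b u ∂μ := by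
  have hind : IndepFun (fun c : I → U => c i) (fun c : I → U => c j)
      (Measure.pi fun _ : I => μ) :=
    (iIndepFun_pi (μ := fun _ : I => μ) (X := fun _ => id) fun _ => aemeasurable_id).indepFun hij
  rw [← lintegral_eval μ i ha, ← lintegral_eval μ j hb]
  exact lintegral_mul_eq_lintegral_mul_lintegral_of_indepFun
    (ha.comp (measurable_pi_apply i)) (hb.comp (measurable_pi_apply j)) (hind.comp ha hb)

open Classical in
/-- The random coding bound for maximum likelihood decoding: the transmitted codeword `c i`
against the competitors `c j`, `j ∈ J`. -/
theorem lintegral_confusion_le_decodingBound (hF : Measurable F) (hΘF : (μ.prod P).withDensity F ≤ Θ)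
    (hμ : Θ.fst = μ) (hP : Θ.snd = P) (ht : Measurable t) {ν : Measure (U × Y)}
    (hν : ν = Θ.map (Prod.map id t)) {i : I} {J : Finset I} (hi : i ∉ J) {n : ℕ}
    (hn : n - 1 = J.card) :
    ∫⁻ c, ∫⁻ ω, F (c i, ω) * (if ∃ j ∈ J, ν.rnDeriv (μ.prod (P.map t)) (c i, t ω)
        ≤ ν.rnDeriv (μ.prod (P.map t)) (c j, t ω) then 1 else 0) ∂P
        ∂(Measure.pi fun _ : I => μ)
      ≤ ENNReal.ofReal (decodingBound ν n) := by
  rw [← add_zero (ENNReal.ofReal _)]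
  unfold decodingBound
  refine le_ofReal_iInf_add (fun γ => by positivity) fun γ => ?_
  rw [add_zero]
  have hidt : Measurable (Prod.map id t : U × Ω → U × Y) := measurable_id.prodMap ht
  have hPt : IsProbabilityMeasure (P.map t) := Measure.isProbabilityMeasure_map ht.aemeasurable
  have hνp : IsProbabilityMeasure ν := by
    rw [hν]; exact Measure.isProbabilityMeasure_map hidt.aemeasurable
  have hνf : ν.fst = μ := by
    rw [hν, Measure.fst, Measure.map_map measurable_fst hidt, ← hμ]; rfl
  have hνs : ν.snd = P.map t := by
    rw [hν, Measure.snd, Measure.map_map measurable_snd hidt, ← hP, Measure.snd,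
      Measure.map_map ht measurable_snd]; rfl
  set π := μ.prod (P.map t) with hπ
  set r := ν.rnDeriv π with hr
  have hrm : Measurable r := Measure.measurable_rnDeriv _ _
  -- Confusion forces either the true metric to be at most `θ` or some competitor to exceed `θ`. The
  -- factor `J.card` pays for the union bound. With no competitors `θ = 0`, which matches `log₂ 0 =
  -- -∞`.
  set θ : ℝ≥0∞ := (J.card : ℝ≥0∞) * ENNReal.ofReal ((2 : ℝ) ^ (γ : ℝ)) with hθ
  set lo : Set (U × Y) := {p | r p ≤ θ} with hlo
  set hi' : Set (U × Y) := {p | θ < r p} with hhi'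
  have hlom : MeasurableSet lo := measurableSet_le hrm measurable_const
  have hhim : MeasurableSet hi' := measurableSet_lt measurable_const hrm
  have hFi : ∀ i : I, Measurable fun p : (I → U) × Ω => F (p.1 i, p.2) := fun i =>
    hF.comp (((measurable_pi_apply i).comp measurable_fst).prodMk measurable_snd)
  have hind : ∀ (s : Set (U × Y)), MeasurableSet s → ∀ j : I,
      Measurable fun p : (I → U) × Ω => s.indicator (1 : U × Y → ℝ≥0∞) (p.1 j, t p.2) :=
    fun s hs j => (measurable_one.indicator hs).comp
      (((measurable_pi_apply j).comp measurable_fst).prodMk (ht.comp measurable_snd))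
  have hpt : ∀ (c : I → U) ω,
      F (c i, ω) * (if ∃ j ∈ J, r (c i, t ω) ≤ r (c j, t ω) then 1 else 0)
      ≤ F (c i, ω) * lo.indicator 1 (c i, t ω)
        + ∑ j ∈ J, F (c i, ω) * hi'.indicator 1 (c j, t ω) := by
    intro c ω
    rw [← Finset.mul_sum, ← mul_add]
    refine mul_le_mul_right ?_ _
    split_ifs with h
    · obtain ⟨j, hj, hle⟩ := h
      by_cases hlt : r (c i, t ω) ≤ θ
      · have : (c i, t ω) ∈ lo := hlt
        simp [this]
      · have : (c j, t ω) ∈ hi' := (not_le.1 hlt).trans_le hle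
        refine le_trans ?_ le_add_self
        refine le_trans ?_ (Finset.single_le_sum (f := fun j => hi'.indicator
          (1 : U × Y → ℝ≥0∞) (c j, t ω)) (fun _ _ => zero_le) hj)
        simp [this]
    · exact zero_le
  have hlow : ∫⁻ c, ∫⁻ ω, F (c i, ω) * lo.indicator 1 (c i, t ω) ∂P
      ∂(Measure.pi fun _ : I => μ)
      ≤ ν {p | infoDensity ν p ≤ log₂ (((n - 1 : ℕ)) : ℝ≥0∞) + (((γ : ℝ)) : EReal)} := by
    have hm : Measurable fun p : U × Ω => F p * lo.indicator 1 (p.1, t p.2) :=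
      hF.mul ((measurable_one.indicator hlom).comp hidt)
    calc ∫⁻ c, ∫⁻ ω, F (c i, ω) * lo.indicator 1 (c i, t ω) ∂P ∂(Measure.pi fun _ : I => μ)
        = ∫⁻ u, ∫⁻ ω, F (u, ω) * lo.indicator 1 (u, t ω) ∂P ∂μ :=
          lintegral_eval μ i (g := fun u => ∫⁻ ω, F (u, ω) * lo.indicator 1 (u, t ω) ∂P)
            hm.lintegral_prod_right'
      _ = (((μ.prod P).withDensity F).map (Prod.map id t)) lo := by
          rw [← lintegral_prod _ hm.aemeasurable, Measure.map_apply hidt hlom,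
            withDensity_apply _ (hidt hlom), ← lintegral_indicator (hidt hlom)]
          refine lintegral_congr fun p => ?_
          by_cases hp : (p.1, t p.2) ∈ lo
          · have : p ∈ Prod.map id t ⁻¹' lo := hp
            simp [hp, this]
          · have : p ∉ Prod.map id t ⁻¹' lo := hp
            simp [hp, this]
      _ ≤ (ν.restrict (regularSet ν π)) lo := by
          rw [restrict_regularSet]
          refine le_withDensity_rnDeriv ?_ (map_withDensity_absolutelyContinuous ht) lo
          rw [hν]
          exact Measure.map_mono hΘF hidt
      _ ≤ _ := by
          rw [Measure.restrict_apply hlom]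
          refine measure_mono fun p hp => ?_
          have : likelihoodRatio ν (ν.fst.prod ν.snd) p ≤ θ := by
            rw [hνf, hνs, likelihoodRatio_of_mem hp.2]
            exact hp.1
          rw [← log₂_strictMono.le_iff_le, hθ, log₂_mul, log₂_two_rpow, ← hn] at this
          exact this
  -- A competitor is independent of the codeword `c i`, which can be integrated out at the price of
  -- a factor at most one.
  have hcross : ∀ j ∈ J, ∫⁻ c, ∫⁻ ω, F (c i, ω) * hi'.indicator 1 (c j, t ω) ∂P
      ∂(Measure.pi fun _ : I => μ) ≤ π hi' := by
    intro j hj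
    have hij : i ≠ j := fun h => hi (h ▸ hj)
    rw [lintegral_lintegral_swap ((hFi i).mul (hind hi' hhim j)).aemeasurable]
    have hF1 : ∀ᵐ ω ∂P, ∫⁻ u, F (u, ω) ∂μ ≤ 1 := lintegral_density_le_one hF hP hΘF
    calc _ ≤ ∫⁻ ω, ∫⁻ u, hi'.indicator 1 (u, t ω) ∂μ ∂P := by
          refine lintegral_mono_ae ?_
          filter_upwards [hF1] with ω hω
          rw [lintegral_pi_mul i j hij (a := fun u => F (u, ω))
            (b := fun u => hi'.indicator 1 (u, t ω)) (hF.comp measurable_prodMk_right)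
            ((measurable_one.indicator hhim).comp measurable_prodMk_right)]
          exact mul_le_of_le_one_left' hω
      _ = π hi' := by
          rw [← lintegral_indicator_one hhim, hπ, lintegral_prod_symm _
            (measurable_one.indicator hhim).aemeasurable,
            lintegral_map (measurable_one.indicator hhim).lintegral_prod_left' ht]
  have hmarkov : (J.card : ℝ≥0∞) * π hi' ≤ ENNReal.ofReal ((2 : ℝ) ^ (-(γ : ℝ))) := by
    -- Markov's inequality in product form, so that `θ = 0` needs no separate case.
    have h1 : θ * π hi' ≤ 1 := by
      calc θ * π hi' ≤ θ * π {p | θ ≤ r p} := by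
            gcongr; exact fun p (hp : θ < r p) => hp.le
        _ ≤ ∫⁻ p, r p ∂π := mul_meas_ge_le_lintegral hrm θ
        _ ≤ ν Set.univ := Measure.lintegral_rnDeriv_le
        _ = 1 := measure_univ
    have h2 : ENNReal.ofReal ((2 : ℝ) ^ (-(γ : ℝ))) * ENNReal.ofReal ((2 : ℝ) ^ (γ : ℝ)) = 1 := by
      rw [← ENNReal.ofReal_mul (by positivity), ← Real.rpow_add two_pos]; simp
    calc (J.card : ℝ≥0∞) * π hi'
        = ENNReal.ofReal ((2 : ℝ) ^ (-(γ : ℝ))) * (θ * π hi') := by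
          rw [hθ, mul_comm (J.card : ℝ≥0∞) (ENNReal.ofReal _), mul_assoc, ← mul_assoc, h2, one_mul]
      _ ≤ _ := mul_le_of_le_one_right' h1
  rw [ENNReal.ofReal_add (by positivity) (by positivity), ofReal_measureReal]
  calc _ ≤ ∫⁻ c, ∫⁻ ω, (F (c i, ω) * lo.indicator 1 (c i, t ω)
        + ∑ j ∈ J, F (c i, ω) * hi'.indicator 1 (c j, t ω)) ∂P ∂(Measure.pi fun _ : I => μ) :=
        lintegral_mono fun c => lintegral_mono fun ω => hpt c ω
    _ = ∫⁻ c, ∫⁻ ω, F (c i, ω) * lo.indicator 1 (c i, t ω) ∂P ∂(Measure.pi fun _ : I => μ)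
        + ∑ j ∈ J, ∫⁻ c, ∫⁻ ω, F (c i, ω) * hi'.indicator 1 (c j, t ω) ∂P
          ∂(Measure.pi fun _ : I => μ) := by
        have hA : Measurable fun p : (I → U) × Ω =>
            F (p.1 i, p.2) * lo.indicator 1 (p.1 i, t p.2) := (hFi i).mul (hind lo hlom i)
        have hB : ∀ j, Measurable fun p : (I → U) × Ω =>
            F (p.1 i, p.2) * hi'.indicator 1 (p.1 j, t p.2) := fun j =>
          (hFi i).mul (hind hi' hhim j)
        rw [← lintegral_finsetSum _ fun j _ => (hB j).lintegral_prod_right',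
          ← lintegral_add_left hA.lintegral_prod_right']
        refine lintegral_congr fun c => ?_
        rw [← lintegral_finsetSum _ fun j _ => measurable_fiber (hB j) c,
          ← lintegral_add_left (measurable_fiber hA c)]
    _ ≤ _ := by
        refine add_le_add hlow ((Finset.sum_le_sum hcross).trans ?_)
        rw [Finset.sum_const, nsmul_eq_mul]
        exact hmarkov

end Decoding

/-! ### Conditional entropy of a nearly uniform key -/

section Entropy

/-- The left side is `v * log (n * v)`, nonpositive for `v ≤ 1 / n`. Otherwise write `v = (v - 1 /
n) + 1 / n` and bound the logarithm by `log n` in the first term and by `n * v - 1` in the second.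
-/
theorem mul_log_sub_negMulLog_le {n v : ℝ} (hn : 1 ≤ n) (h0 : 0 ≤ v) (h1 : v ≤ 1) :
    v * Real.log n - Real.negMulLog v ≤ (Real.log n + 1) * max (v - 1 / n) 0 := by
  have hn0 : 0 < n := by linarith
  have hlog : 0 ≤ Real.log n := Real.log_nonneg hn
  rcases h0.eq_or_lt with rfl | hv
  · simp only [zero_mul, Real.negMulLog_zero, sub_zero]; positivity
  have e : v * Real.log n - Real.negMulLog v = v * Real.log (n * v) := by
    rw [Real.negMulLog, Real.log_mul hn0.ne' hv.ne']; ring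
  rw [e]
  rcases le_total v (1 / n) with h | h
  · have : Real.log (n * v) ≤ 0 := Real.log_nonpos (by positivity)
      (by rw [le_div_iff₀ hn0] at h; linarith)
    exact (mul_nonpos_of_nonneg_of_nonpos h0 this).trans (by positivity)
  · have hA : Real.log (n * v) ≤ Real.log n :=
      Real.log_le_log (by positivity) (by nlinarith)
    have hB : Real.log (n * v) ≤ n * v - 1 := Real.log_le_sub_one_of_pos (by positivity)
    rw [max_eq_left (by linarith)]
    calc v * Real.log (n * v) = (v - 1 / n) * Real.log (n * v) + 1 / n * Real.log (n * v) := by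
          ring
      _ ≤ (v - 1 / n) * Real.log n + 1 / n * (n * v - 1) := by
          have : 0 ≤ v - 1 / n := by linarith
          gcongr
      _ = (Real.log n + 1) * (v - 1 / n) := by field_simp

variable {Ω S T : Type*} [MeasurableSpace Ω] [MeasurableSpace T] [Nonempty S]
  [MeasurableSpace S] [StandardBorelSpace S] {K : Ω → S} {V : Ω → T}
  (μ : Measure Ω) [IsProbabilityMeasure μ]

theorem setIntegral_condDistrib_real (hK : Measurable K) (hV : Measurable V) (k : S) {B : Set T}
    (hB : MeasurableSet B) :
    ∫ v in B, (condDistrib K V μ v).real {k} ∂(μ.map V) = μ.real (V ⁻¹' B ∩ K ⁻¹' {k}) := by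
  have hm : Measurable fun v => condDistrib K V μ v {k} := Kernel.measurable_coe _ (by measurability)
  simp only [measureReal_def]
  rw [integral_toReal hm.aemeasurable (ae_of_all _ fun v => measure_lt_top _ _),
    setLIntegral_map hB hm hV,
    setLIntegral_preimage_condDistrib hV hK.aemeasurable (by measurability) hB]

variable [Fintype S]

theorem condEntropy_nonneg : 0 ≤ condEntropy K V μ := by
  refine integral_nonneg fun v => div_nonneg (Finset.sum_nonneg fun k _ => ?_)
    (Real.log_nonneg one_le_two)
  exact Real.negMulLog_nonneg measureReal_nonneg measureReal_le_one

/-- If, up to errors `p k` and `q k`, the joint law of `V` and `K` gives every key `k` the same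
measure `ρ`, then the conditional entropy of `K` given `V` is nearly maximal. -/
theorem logb_card_sub_condEntropy_le (hK : Measurable K) (hV : Measurable V) (ρ : Set T → ℝ)
    (p q : S → ℝ)
    (hp : ∀ k B, MeasurableSet B → μ.real (V ⁻¹' B ∩ K ⁻¹' {k}) ≤ ρ B + p k)
    (hq : ∀ k B, MeasurableSet B → ρ B ≤ μ.real (V ⁻¹' B ∩ K ⁻¹' {k}) + q k) :
    Real.logb 2 (Fintype.card S) - condEntropy K V μ
      ≤ (Real.log (Fintype.card S) + 1) * (∑ k, (p k + q k)) / Real.log 2 := by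
  set n : ℝ := (Fintype.card S : ℝ) with hn
  have hn1 : 1 ≤ n := by rw [hn]; exact_mod_cast Fintype.card_pos
  have hn0 : 0 < n := by linarith
  have hlog2 : 0 < Real.log 2 := Real.log_pos one_lt_two
  have hVp : IsProbabilityMeasure (μ.map V) := Measure.isProbabilityMeasure_map hV.aemeasurable
  set κ : T → S → ℝ := fun v k => (condDistrib K V μ v).real {k} with hκ
  have hκm : ∀ k, Measurable fun v => κ v k := fun k =>
    (Kernel.measurable_coe _ (by measurability)).ennreal_toReal
  have hκ0 : ∀ v k, 0 ≤ κ v k := fun v k => measureReal_nonneg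
  have hκ1 : ∀ v k, κ v k ≤ 1 := fun v k => measureReal_le_one
  have hκs : ∀ v, ∑ k, κ v k = 1 := by
    intro v
    simp [hκ]
  have hκi : ∀ k, Integrable (fun v => κ v k) (μ.map V) := fun k =>
    Integrable.of_mem_Icc 0 1 (hκm k).aemeasurable (ae_of_all _ fun v => ⟨hκ0 v k, hκ1 v k⟩)
  have hmaxi : ∀ k, Integrable (fun v => max (κ v k - 1 / n) 0) (μ.map V) := fun k =>
    ((hκi k).sub (integrable_const _)).pos_part
  have hneg : ∀ k, Integrable (fun v => Real.negMulLog (κ v k)) (μ.map V) := fun k =>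
    Integrable.of_mem_Icc 0 1 (Real.continuous_negMulLog.measurable.comp (hκm k)).aemeasurable
      (ae_of_all _ fun v => ⟨Real.negMulLog_nonneg (hκ0 v k) (hκ1 v k), by
        have := Real.negMulLog_le_one_sub_self (hκ0 v k)
        linarith [hκ0 v k]⟩)
  have hmax : ∀ k, ∫ v, max (κ v k - 1 / n) 0 ∂(μ.map V) ≤ p k + (∑ j, q j) / n := by
    intro k
    -- The positive part is the signed deviation integrated over `B`, so the set-wise hypotheses on
    -- `ρ` can be applied to it.
    set B : Set T := {v | 1 / n ≤ κ v k} with hB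
    have hBm : MeasurableSet B := measurableSet_le measurable_const (hκm k)
    have e1 : ∀ v, max (κ v k - 1 / n) 0 = B.indicator (fun v => κ v k - 1 / n) v := by
      intro v
      by_cases hv : v ∈ B
      · rw [Set.indicator_of_mem hv, max_eq_left]
        have : 1 / n ≤ κ v k := hv
        linarith
      · rw [Set.indicator_of_notMem hv, max_eq_right]
        have : κ v k < 1 / n := not_le.1 hv
        linarith
    have e2 : ∫ v, max (κ v k - 1 / n) 0 ∂(μ.map V)
        = μ.real (V ⁻¹' B ∩ K ⁻¹' {k}) - μ.real (V ⁻¹' B) / n := by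
      simp_rw [e1]
      rw [integral_indicator hBm, integral_sub (hκi k).integrableOn (integrable_const _),
        setIntegral_condDistrib_real μ hK hV k hBm, setIntegral_const,
        map_measureReal_apply hV hBm]
      simp [div_eq_mul_inv]
    have e3 : μ.real (V ⁻¹' B) = ∑ j, μ.real (V ⁻¹' B ∩ K ⁻¹' {j}) := by
      calc μ.real (V ⁻¹' B) = ∫ _ in B, (1 : ℝ) ∂(μ.map V) := by
            simp [map_measureReal_apply hV hBm]
        _ = ∫ v in B, ∑ j, κ v j ∂(μ.map V) := by simp only [hκs]
        _ = ∑ j, ∫ v in B, κ v j ∂(μ.map V) := integral_finsetSum _ fun j _ => (hκi j).integrableOn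
        _ = _ := Finset.sum_congr rfl fun j _ => setIntegral_condDistrib_real μ hK hV j hBm
    -- Summing the lower estimates over all keys eliminates `ρ` in favour of the marginal of `V`;
    -- only the upper estimate for `k` itself is then needed.
    have e4 : n * ρ B ≤ μ.real (V ⁻¹' B) + ∑ j, q j := by
      calc n * ρ B = ∑ _j : S, ρ B := by simp [hn]
        _ ≤ ∑ j, (μ.real (V ⁻¹' B ∩ K ⁻¹' {j}) + q j) := Finset.sum_le_sum fun j _ => hq j B hBm
        _ = _ := by rw [Finset.sum_add_distrib, e3]
    have e5 : ρ B ≤ μ.real (V ⁻¹' B) / n + (∑ j, q j) / n := by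
      rw [← add_div, le_div_iff₀ hn0]; linarith
    rw [e2]
    linarith [hp k B hBm]
  have hpt : ∀ v, Real.log n - ∑ k, Real.negMulLog (κ v k)
      ≤ (Real.log n + 1) * ∑ k, max (κ v k - 1 / n) 0 := by
    intro v
    calc Real.log n - ∑ k, Real.negMulLog (κ v k)
        = ∑ k, (κ v k * Real.log n - Real.negMulLog (κ v k)) := by
          rw [Finset.sum_sub_distrib, ← Finset.sum_mul, hκs, one_mul]
      _ ≤ _ := by
          rw [Finset.mul_sum]
          exact Finset.sum_le_sum fun k _ => mul_log_sub_negMulLog_le hn1 (hκ0 v k) (hκ1 v k)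
  have hnegs : Integrable (fun v => ∑ k, Real.negMulLog (κ v k)) (μ.map V) :=
    integrable_finsetSum _ fun k _ => hneg k
  have hint : Real.log n - ∫ v, ∑ k, Real.negMulLog (κ v k) ∂(μ.map V)
      ≤ (Real.log n + 1) * ∑ k, (p k + q k) := by
    calc Real.log n - ∫ v, ∑ k, Real.negMulLog (κ v k) ∂(μ.map V)
        = ∫ v, (Real.log n - ∑ k, Real.negMulLog (κ v k)) ∂(μ.map V) := by
          rw [integral_sub (integrable_const _) hnegs]; simp
      _ ≤ ∫ v, (Real.log n + 1) * ∑ k, max (κ v k - 1 / n) 0 ∂(μ.map V) :=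
          integral_mono ((integrable_const _).sub hnegs)
            ((integrable_finsetSum _ fun k _ => hmaxi k).const_mul _) hpt
      _ = (Real.log n + 1) * ∑ k, ∫ v, max (κ v k - 1 / n) 0 ∂(μ.map V) := by
          rw [integral_const_mul, integral_finsetSum _ fun k _ => hmaxi k]
      _ ≤ (Real.log n + 1) * ∑ k, (p k + (∑ j, q j) / n) := by
          have := Real.log_nonneg hn1
          gcongr with k
          exact hmax k
      _ = _ := by
          rw [Finset.sum_add_distrib, Finset.sum_add_distrib, Finset.sum_const, Finset.card_univ,
            nsmul_eq_mul, ← hn, mul_div_cancel₀ _ hn0.ne']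
  rw [condEntropy, integral_div, Real.logb, ← sub_div]
  gcongr

/-- The final estimate on the leakage, with a free parameter `δ`. -/
theorem le_mul_logb_of_le {n : ℕ} [NeZero n] {x D T : ℝ} (hD : D ≤ T) (hT : 0 ≤ T)
    (hx : x ≤ (Real.log n + 1) * D / Real.log 2) (hx' : x ≤ Real.logb 2 n)
    {δ : ℝ} (hδ : 0 < δ) (hδ' : δ < Real.exp (-1) * (n : ℝ) ^ (3 / 2 : ℝ)) :
    x ≤ (T + 8 * δ) * Real.logb 2 ((n : ℝ) ^ (3 / 2 : ℝ) / δ) := by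
  have hn1 : (1 : ℝ) ≤ n := by exact_mod_cast NeZero.one_le
  have hn0 : (0 : ℝ) < n := by linarith
  have hlog2 : 0 < Real.log 2 := Real.log_pos one_lt_two
  have hlogn : 0 ≤ Real.log n := Real.log_nonneg hn1
  set L := Real.log ((n : ℝ) ^ (3 / 2 : ℝ) / δ) with hL
  have hLe : L = 3 / 2 * Real.log n - Real.log δ := by
    rw [hL, Real.log_div (by positivity) hδ.ne', Real.log_rpow hn0]
  have hlogδ : Real.log δ < 3 / 2 * Real.log n - 1 := by
    have := Real.log_lt_log hδ hδ'
    rw [Real.log_mul (Real.exp_pos _).ne' (by positivity), Real.log_exp, Real.log_rpow hn0] at this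
    linarith
  have hL1 : 1 < L := by linarith
  rw [Real.logb, ← hL, mul_div_assoc']
  -- If `L` dominates `log n + 1`, the distance bound suffices. Otherwise `δ` is so large, above `√n
  -- / e`, that the trivial bound `log n ≤ 2 * (√n - 1) < 6 * δ` already wins, as `L > 1`.
  rcases le_or_gt (Real.log n + 1) L with h | h
  · refine hx.trans (div_le_div_of_nonneg_right ?_ hlog2.le)
    calc (Real.log n + 1) * D ≤ (Real.log n + 1) * T := by gcongr
      _ ≤ L * T := by gcongr
      _ ≤ (T + 8 * δ) * L := by nlinarith [mul_pos hδ (by linarith : 0 < L)]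
  · refine hx'.trans ?_
    rw [Real.logb]
    gcongr
    have h1 : Real.log (√n) - 1 < Real.log δ := by
      rw [Real.log_sqrt hn0.le]; linarith
    have h2 : Real.log (√n) ≤ √n - 1 := Real.log_le_sub_one_of_pos (by positivity)
    rw [Real.log_sqrt hn0.le] at h2
    have h3 : √n < 3 * δ := by
      have h4 : √n < Real.exp 1 * δ := by
        rw [← Real.log_lt_log_iff (by positivity) (by positivity),
          Real.log_mul (Real.exp_pos _).ne' hδ.ne', Real.log_exp]
        linarith
      have := Real.exp_one_lt_d9
      nlinarith
    nlinarith

end Entropy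

/-! ### The random codebook -/

section DensityOfImage

variable {U Ω Z : Type*} [MeasurableSpace U] [MeasurableSpace Ω] [MeasurableSpace Z]

/-- Joint measurability of `g` and `F` lets the identities for fixed `u` be integrated over the
sections of a set. -/
theorem withDensity_density_map {μ : Measure U} [IsProbabilityMeasure μ] {P : Measure Ω}
    [IsProbabilityMeasure P] {t : Ω → Z} (ht : Measurable t) {F : U × Ω → ℝ≥0∞}
    (hF : Measurable F) {g : U × Z → ℝ≥0∞} (hg : Measurable g)
    (h : ∀ u, ∀ C, MeasurableSet C →
      ∫⁻ ω in t ⁻¹' C, F (u, ω) ∂P = ∫⁻ z in C, g (u, z) ∂(P.map t)) :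
    (μ.prod (P.map t)).withDensity g = ((μ.prod P).withDensity F).map (Prod.map id t) := by
  have hPt : IsProbabilityMeasure (P.map t) := Measure.isProbabilityMeasure_map ht.aemeasurable
  have hidt : Measurable (Prod.map id t : U × Ω → U × Z) := measurable_id.prodMap ht
  ext E hE
  rw [Measure.map_apply hidt hE, withDensity_apply _ hE, withDensity_apply _ (hidt hE),
    ← lintegral_indicator hE, ← lintegral_indicator (hidt hE),
    lintegral_prod _ (hg.indicator hE).aemeasurable,
    lintegral_prod _ (hF.indicator (hidt hE)).aemeasurable]
  refine lintegral_congr fun u => ?_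
  have hEu : MeasurableSet (Prod.mk u ⁻¹' E) := measurable_prodMk_left hE
  have := h u _ hEu
  rw [← lintegral_indicator hEu, ← lintegral_indicator (ht hEu)] at this
  exact this.symm

end DensityOfImage

section Moments

variable {X Y Z U : Type*} [MeasurableSpace X] [MeasurableSpace Y] [MeasurableSpace Z]
  [MeasurableSpace U] (P : Measure (X × Y × Z)) [IsProbabilityMeasure P]
  (Q : Kernel X U) [IsMarkovKernel Q]

/-- The mass of the singular part of the law of `(U, X)`. -/
noncomputable def singularMass : ℝ≥0∞ :=
  1 - ((lawU P Q).prod P).withDensity (sourceLikelihood P Q) Set.univ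

theorem withDensity_likelihood : ((lawU P Q).prod (P.map fun ω => ω.1)).withDensity
      (fun p => ENNReal.ofReal (likelihood P Q p.1 p.2))
    = (((lawU P Q).prod P).withDensity (sourceLikelihood P Q)).map
      (Prod.map id fun ω => ω.1) := by
  refine withDensity_density_map measurable_fst (measurable_sourceLikelihood P Q)
    (measurable_likelihood P Q).ennreal_ofReal fun u C hC => ?_
  exact (setLIntegral_map hC (measurable_fiber (measurable_likelihood P Q).ennreal_ofReal u)
    measurable_fst).symm

/-- For every `τ` the singular part lies in the tail `ı > τ`, so the first term of the covering
bound already pays for it; `N` plays no role. -/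
theorem singularMass_le (N : ℕ) :
    singularMass P Q ≤ ENNReal.ofReal (coveringBound (lawUX P Q) N) := by
  have hm : Measurable fun ω : X × Y × Z => ω.1 := measurable_fst
  have hp := isProbabilityMeasure_map_jointLaw P Q hm
  have h1 := fst_map_jointLaw P Q hm
  have h2 := snd_map_jointLaw P Q hm
  rw [← lawUX_eq] at hp h1 h2
  have hPm : IsProbabilityMeasure (P.map fun ω => ω.1) :=
    Measure.isProbabilityMeasure_map hm.aemeasurable
  rw [← add_zero (ENNReal.ofReal _)]
  unfold coveringBound
  refine le_ofReal_iInf_add (fun τ => by positivity) fun τ => ?_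
  rw [add_zero, ENNReal.ofReal_add (by positivity) (by positivity), ofReal_measureReal]
  refine le_trans (tsub_le_iff_left.2 ?_) le_self_add
  refine (one_le_withDensity_add h1 h2 (τ : ℝ)).trans (add_le_add_left ?_ _)
  rw [← withDensity_congr_ae (likelihood_ae_eq P Q), withDensity_likelihood]
  refine (measure_mono (Set.subset_univ _)).trans ?_
  rw [Measure.map_apply (measurable_id.prodMap hm) MeasurableSet.univ, Set.preimage_univ]

variable {I ι : Type*} [Fintype I] [Fintype ι] [Nonempty ι] {e : ι → I}

/-- The likelihood depends on the source only through `X`, so soft covering is applied to the law of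
`(U, X)`, where it is the full absolutely continuous density and the slack `d` vanishes. -/
theorem lintegral_source_codeAverage_le (he : Function.Injective e) :
    ∫⁻ c, ∫⁻ ω, (1 - codeAverage e (fun u => sourceLikelihood P Q (u, ω)) c) ∂P
        ∂(Measure.pi fun _ : I => lawU P Q)
      ≤ ENNReal.ofReal (coveringBound (lawUX P Q) (Fintype.card ι)) := by
  have hm : Measurable fun ω : X × Y × Z => ω.1 := measurable_fst
  have hp := isProbabilityMeasure_map_jointLaw P Q hm
  have h1 := fst_map_jointLaw P Q hm
  have h2 := snd_map_jointLaw P Q hm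
  rw [← lawUX_eq] at hp h1 h2
  have hPm : IsProbabilityMeasure (P.map fun ω => ω.1) :=
    Measure.isProbabilityMeasure_map hm.aemeasurable
  have hg : Measurable fun p : U × X => ENNReal.ofReal (likelihood P Q p.1 p.2) :=
    (measurable_likelihood P Q).ennreal_ofReal
  have heq := withDensity_congr_ae (likelihood_ae_eq P Q)
  have hle : ((lawU P Q).prod (P.map fun ω => ω.1)).withDensity
      (fun p => ENNReal.ofReal (likelihood P Q p.1 p.2)) ≤ lawUX P Q :=
    heq.le.trans (Measure.withDensity_rnDeriv_le _ _)
  have hd : ∀ s, MeasurableSet s → ((lawU P Q).prod (P.map fun ω => ω.1)).withDensity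
      ((lawUX P Q).rnDeriv ((lawU P Q).prod (P.map fun ω => ω.1))) s
      ≤ ((lawU P Q).prod (P.map fun ω => ω.1)).withDensity
      (fun p => ENNReal.ofReal (likelihood P Q p.1 p.2)) s + 0 := fun s _ => by
    rw [heq, add_zero]
  have key := lintegral_one_sub_codeAverage_le_coveringBound (I := I) he h1 h2 hg hle hd
  rw [add_zero] at key
  refine le_trans (lintegral_mono fun c => ?_) key
  have hc : Measurable fun x : X =>
      1 - codeAverage e (fun u => ENNReal.ofReal (likelihood P Q u x)) c :=
    (measurable_fiber (measurable_codeAverage_prod e hg) c).const_sub 1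
  rw [lintegral_map hc hm]
  simp only [sourceLikelihood, le_refl]

theorem lintegral_sourceLikelihood_le_one :
    ∀ᵐ ω ∂P, ∫⁻ u, sourceLikelihood P Q (u, ω) ∂(lawU P Q) ≤ 1 :=
  lintegral_density_le_one (measurable_sourceLikelihood P Q) (jointLaw_snd P Q)
    (withDensity_sourceLikelihood_le P Q)

variable {g : U × Z → ℝ≥0∞}

/-- The density `g` of the images on `Z` of the measures with density `sourceLikelihood` satisfies
the hypotheses of soft covering for the law of `(U, Z)`. -/
theorem withDensity_map_le_lawUZ (hg : Measurable g)
    (h : ∀ u, ∀ C, MeasurableSet C → ∫⁻ ω in (fun ω => ω.2.2) ⁻¹' C, sourceLikelihood P Q (u, ω) ∂P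
      = ∫⁻ z in C, g (u, z) ∂(P.map fun ω => ω.2.2)) :
    ((lawU P Q).prod (P.map fun ω => ω.2.2)).withDensity g ≤ lawUZ P Q := by
  have hm : Measurable fun ω : X × Y × Z => ω.2.2 := by fun_prop
  rw [withDensity_density_map hm (measurable_sourceLikelihood P Q) hg h, lawUZ_eq]
  exact Measure.map_mono (withDensity_sourceLikelihood_le P Q) (measurable_id.prodMap hm)

/-- A part of the law of `(U, X)` that is singular may become absolutely continuous on `Z`, so `g`
can fall short of the density of `(U, Z)`. The shortfall has mass at most `singularMass`. -/
theorem lintegral_output_codeAverage_le (he : Function.Injective e) (hg : Measurable g)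
    (h : ∀ u, ∀ C, MeasurableSet C → ∫⁻ ω in (fun ω => ω.2.2) ⁻¹' C, sourceLikelihood P Q (u, ω) ∂P
      = ∫⁻ z in C, g (u, z) ∂(P.map fun ω => ω.2.2)) :
    ∫⁻ c, ∫⁻ z, (1 - codeAverage e (fun u => g (u, z)) c) ∂(P.map fun ω => ω.2.2)
        ∂(Measure.pi fun _ : I => lawU P Q)
      ≤ ENNReal.ofReal (coveringBound (lawUZ P Q) (Fintype.card ι)) + singularMass P Q := by
  have hm : Measurable fun ω : X × Y × Z => ω.2.2 := by fun_prop
  have hp := isProbabilityMeasure_map_jointLaw P Q hm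
  have h1 := fst_map_jointLaw P Q hm
  have h2 := snd_map_jointLaw P Q hm
  rw [← lawUZ_eq] at hp h1 h2
  have hPm : IsProbabilityMeasure (P.map fun ω => ω.2.2) :=
    Measure.isProbabilityMeasure_map hm.aemeasurable
  have hle := withDensity_map_le_lawUZ P Q hg h
  refine lintegral_one_sub_codeAverage_le_coveringBound he h1 h2 hg hle fun s hs => ?_
  refine (Measure.withDensity_rnDeriv_le _ _ s).trans ?_
  set α := ((lawU P Q).prod (P.map fun ω => ω.2.2)).withDensity g with hα
  have hmass : singularMass P Q = 1 - α Set.univ := by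
    rw [singularMass, hα, withDensity_density_map hm (measurable_sourceLikelihood P Q) hg h,
      Measure.map_apply (measurable_id.prodMap hm) MeasurableSet.univ, Set.preimage_univ]
  have hsc : lawUZ P Q s + α sᶜ ≤ 1 := by
    calc lawUZ P Q s + α sᶜ ≤ lawUZ P Q s + lawUZ P Q sᶜ := add_le_add_right (hle _) _
      _ = 1 := by rw [measure_add_measure_compl hs, measure_univ]
  have hfin : α sᶜ ≠ ∞ := ((le_add_self.trans hsc).trans_lt ENNReal.one_lt_top).ne
  have huniv : α Set.univ = α s + α sᶜ := (measure_add_measure_compl hs).symm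
  have : lawUZ P Q s + α sᶜ ≤ (α s + singularMass P Q) + α sᶜ := by
    refine hsc.trans ?_
    rw [hmass, add_right_comm, ← huniv]
    exact le_add_tsub
  exact (ENNReal.add_le_add_iff_right hfin).1 this

theorem lintegral_output_density_le_one (hg : Measurable g)
    (h : ∀ u, ∀ C, MeasurableSet C → ∫⁻ ω in (fun ω => ω.2.2) ⁻¹' C, sourceLikelihood P Q (u, ω) ∂P
      = ∫⁻ z in C, g (u, z) ∂(P.map fun ω => ω.2.2)) :
    ∀ᵐ z ∂(P.map fun ω => ω.2.2), ∫⁻ u, g (u, z) ∂(lawU P Q) ≤ 1 := by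
  have hm : Measurable fun ω : X × Y × Z => ω.2.2 := by fun_prop
  have h2 := snd_map_jointLaw P Q hm
  rw [← lawUZ_eq] at h2
  have hPm : IsProbabilityMeasure (P.map fun ω => ω.2.2) :=
    Measure.isProbabilityMeasure_map hm.aemeasurable
  exact lintegral_density_le_one hg h2 (withDensity_map_le_lawUZ P Q hg h)

end Moments

/-! ### Choosing a codebook and a measurable maximizer -/

section Selection

/-- The sum `A / (2a) + B / (2b)` has mean at most one, hence is at most one somewhere. Two separate
Markov bounds would only give strict inequalities with a larger factor. -/
theorem exists_le_two_mul {Ω : Type*} [MeasurableSpace Ω] {μ : Measure Ω} [IsProbabilityMeasure μ]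
    {A B : Ω → ℝ≥0∞} (hA : Measurable A) (hB : Measurable B) {a b : ℝ} (ha : 0 < a) (hb : 0 < b)
    (hAa : ∫⁻ ω, A ω ∂μ ≤ ENNReal.ofReal a) (hBb : ∫⁻ ω, B ω ∂μ ≤ ENNReal.ofReal b) :
    ∃ ω, A ω ≤ ENNReal.ofReal (2 * a) ∧ B ω ≤ ENNReal.ofReal (2 * b) := by
  have half : ∀ {x : ℝ} {D : Ω → ℝ≥0∞}, 0 < x → Measurable D → ∫⁻ ω, D ω ∂μ ≤ ENNReal.ofReal x →
      ∫⁻ ω, D ω / ENNReal.ofReal (2 * x) ∂μ ≤ ENNReal.ofReal (1 / 2) := by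
    intro x D hx hD h
    simp only [div_eq_mul_inv (D _)]
    rw [lintegral_mul_const _ hD, ← div_eq_mul_inv]
    refine (ENNReal.div_le_div_right h _).trans ?_
    rw [← ENNReal.ofReal_div_of_pos (by positivity)]
    exact ENNReal.ofReal_le_ofReal (by field_simp; rfl)
  obtain ⟨ω, hω⟩ := exists_le_lintegral (μ := μ)
    (f := fun ω => A ω / ENNReal.ofReal (2 * a) + B ω / ENNReal.ofReal (2 * b))
    ((hA.div_const _).add (hB.div_const _)).aemeasurable
  rw [lintegral_add_left (hA.div_const _)] at hω
  have h1 : A ω / ENNReal.ofReal (2 * a) + B ω / ENNReal.ofReal (2 * b) ≤ 1 := by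
    refine hω.trans ((add_le_add (half ha hA hAa) (half hb hB hBb)).trans ?_)
    rw [← ENNReal.ofReal_add (by norm_num) (by norm_num)]
    norm_num
  have conv : ∀ {x : ℝ} {y : ℝ≥0∞}, 0 < x → y / ENNReal.ofReal (2 * x) ≤ 1 →
      y ≤ ENNReal.ofReal (2 * x) := by
    intro x y hx h
    rwa [ENNReal.div_le_iff (by simpa using hx) ENNReal.ofReal_ne_top, one_mul] at h
  exact ⟨ω, conv ha (le_self_add.trans h1), conv hb (le_add_self.trans h1)⟩

theorem exists_measurable_argmax {Y J : Type*} [MeasurableSpace Y] [Finite J] [Nonempty J]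
    [MeasurableSpace J] [MeasurableSingletonClass J] {r : J → Y → ℝ≥0∞}
    (hr : ∀ j, Measurable (r j)) : ∃ s : Y → J, Measurable s ∧ ∀ y j, r j y ≤ r (s y) y := by
  classical
  have := Fintype.ofFinite J
  suffices h : ∀ S : Finset J, ∃ s : Y → J, Measurable s ∧ ∀ y, ∀ j ∈ S, r j y ≤ r (s y) y by
    obtain ⟨s, hs, h⟩ := h Finset.univ
    exact ⟨s, hs, fun y j => h y j (Finset.mem_univ j)⟩
  intro S
  induction S using Finset.induction_on with
  | empty => exact ⟨fun _ => Classical.arbitrary J, measurable_const, by simp⟩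
  | insert a S _ ih =>
    obtain ⟨s, hs, h⟩ := ih
    have hrs : Measurable fun y => r (s y) y := by
      have : Measurable fun p : J × Y => r p.1 p.2 := measurable_from_prod_countable_right hr
      exact this.comp (hs.prodMk measurable_id)
    refine ⟨fun y => if r (s y) y ≤ r a y then a else s y,
      Measurable.ite (measurableSet_le hrs (hr a)) measurable_const hs, fun y j hj => ?_⟩
    dsimp only
    rcases Finset.mem_insert.1 hj with rfl | hj
    · split_ifs with hle
      · exact le_rfl
      · exact (not_le.1 hle).le
    · split_ifs with hle
      · exact (h y j hj).trans hle
      · exact h y j hj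

end Selection

/-! ### The likelihood encoder -/

section Encoder

variable {X Y Z U I : Type*} [MeasurableSpace X] [MeasurableSpace Y] [MeasurableSpace Z]
  [MeasurableSpace U] [Fintype I] (P : Measure (X × Y × Z)) (Q : Kernel X U) (c : I → U)

theorem likelihood_nonneg (u : U) (x : X) : 0 ≤ likelihood P Q u x := ENNReal.toReal_nonneg

theorem likelihoodEncoder_nonneg (x : X) (i : I) : 0 ≤ likelihoodEncoder P Q c x i := by
  unfold likelihoodEncoder
  split_ifs
  · positivity
  · exact div_nonneg (likelihood_nonneg P Q _ _)
      (Finset.sum_nonneg fun _ _ => likelihood_nonneg P Q _ _)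

theorem sum_likelihoodEncoder [Nonempty I] (x : X) : ∑ i, likelihoodEncoder P Q c x i = 1 := by
  unfold likelihoodEncoder
  split_ifs with h
  · simp
  · rw [← Finset.sum_div, div_self h]

theorem measurable_likelihoodEncoder (i : I) :
    Measurable fun x => likelihoodEncoder P Q c x i := by
  have hl : ∀ u, Measurable fun x => likelihood P Q u x := fun u =>
    (measurable_likelihood P Q).comp measurable_prodMk_left
  have hs : Measurable fun x => ∑ j, likelihood P Q (c j) x :=
    Finset.measurable_sum _ fun j _ => hl (c j)
  exact Measurable.ite (hs (measurableSet_singleton 0)) measurable_const ((hl (c i)).div hs)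

/-- The probability of the index `i` in the likelihood encoder. -/
noncomputable def encWeight (i : I) (x : X) : ℝ≥0∞ :=
  ENNReal.ofReal (likelihoodEncoder P Q c x i)

theorem measurable_encWeight (i : I) : Measurable (encWeight P Q c i) :=
  (measurable_likelihoodEncoder P Q c i).ennreal_ofReal

theorem sum_encWeight [Nonempty I] (x : X) : ∑ i, encWeight P Q c i x = 1 := by
  simp only [encWeight]
  rw [← ENNReal.ofReal_sum_of_nonneg fun i _ => likelihoodEncoder_nonneg P Q c x i,
    sum_likelihoodEncoder, ENNReal.ofReal_one]

/-- Normalization cancels the codebook average. In product form the identity survives the uniform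
fallback, where every likelihood vanishes. -/
theorem encWeight_mul_codeAverage (i : I) (ω : X × Y × Z) :
    encWeight P Q c i ω.1 * codeAverage id (fun u => sourceLikelihood P Q (u, ω)) c
      = sourceLikelihood P Q (c i, ω) / Fintype.card I := by
  have h0 : ∀ j ∈ Finset.univ, 0 ≤ likelihood P Q (c j) ω.1 := fun j _ => likelihood_nonneg P Q _ _
  have hsum : ∑ j, sourceLikelihood P Q (c j, ω)
      = ENNReal.ofReal (∑ j, likelihood P Q (c j) ω.1) := by
    rw [ENNReal.ofReal_sum_of_nonneg h0]; rfl
  simp only [codeAverage, id]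
  rw [hsum, ← mul_div_assoc, encWeight, ← ENNReal.ofReal_mul (likelihoodEncoder_nonneg P Q c _ _)]
  congr 1
  rw [sourceLikelihood]
  congr 1
  unfold likelihoodEncoder
  split_ifs with h
  · rw [h, mul_zero, (Finset.sum_eq_zero_iff_of_nonneg h0).1 h i (Finset.mem_univ i)]
  · exact div_mul_cancel₀ _ h

variable {M M₁ M₂ : ℕ} (c : Fin M × Fin M₁ × Fin M₂ → U)

/-- The likelihood encoder with codebook `c`, as a Markov kernel to messages and keys. -/
noncomputable def encoder : Kernel X (Fin M × Fin M₁) where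
  toFun x := ∑ i, encWeight P Q c i x • Measure.dirac (i.1, i.2.1)
  measurable' := by
    refine Measure.measurable_of_measurable_coe _ fun s hs => ?_
    simp only [Measure.coe_finsetSum, Measure.coe_smul, Finset.sum_apply, Pi.smul_apply,
      smul_eq_mul]
    exact Finset.measurable_sum _ fun i _ => (measurable_encWeight P Q c i).mul_const _

theorem encoder_apply (x : X) (s : Set (Fin M × Fin M₁)) :
    encoder P Q c x s = ∑ i, encWeight P Q c i x * s.indicator 1 (i.1, i.2.1) := by
  change (∑ i, encWeight P Q c i x • Measure.dirac (i.1, i.2.1) : Measure (Fin M × Fin M₁)) s = _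
  simp only [Measure.coe_finsetSum, Measure.coe_smul, Finset.sum_apply, Pi.smul_apply,
    smul_eq_mul, Measure.dirac_apply]

instance [NeZero M] [NeZero M₁] [NeZero M₂] : IsMarkovKernel (encoder P Q c) := ⟨fun x => ⟨by
  rw [encoder_apply]; simpa using sum_encWeight P Q c x⟩⟩

theorem encoder_real_singleton (x : X) (w : Fin M) (k : Fin M₁) :
    (encoder P Q c x).real {(w, k)} = ∑ l, likelihoodEncoder P Q c x (w, k, l) := by
  have h : encoder P Q c x {(w, k)}
      = ENNReal.ofReal (∑ l, likelihoodEncoder P Q c x (w, k, l)) := by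
    rw [encoder_apply, ENNReal.ofReal_sum_of_nonneg fun l _ => likelihoodEncoder_nonneg P Q c _ _]
    simp only [Fintype.sum_prod_type, Set.indicator_apply, Set.mem_singleton_iff, Prod.mk.injEq]
    rw [Finset.sum_eq_single w (fun w' _ h => by simp [h]) (by simp),
      Finset.sum_eq_single k (fun k' _ h => by simp [h]) (by simp)]
    simp [encWeight]
  rw [measureReal_def, h, ENNReal.toReal_ofReal
    (Finset.sum_nonneg fun l _ => likelihoodEncoder_nonneg P Q c _ _)]

variable [IsProbabilityMeasure P]

theorem law_apply (S : Scheme X Y M M₁) (hS : S.enc = encoder P Q c)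
    {A : Set ((X × Y × Z) × (Fin M × Fin M₁))} (hA : MeasurableSet A) :
    S.law P A = ∫⁻ ω, ∑ i, encWeight P Q c i ω.1 * A.indicator 1 (ω, (i.1, i.2.1)) ∂P := by
  rw [Scheme.law, Measure.compProd_apply hA]
  refine lintegral_congr fun ω => ?_
  rw [Kernel.comap_apply, hS, encoder_apply]
  rfl

end Encoder

/-! ### Comparison of the encoder's law with the ideal one -/

section KeyMass

variable {U Ω Z I ι : Type*} [MeasurableSpace U] [MeasurableSpace Ω] [MeasurableSpace Z]
  [Fintype ι] {P : Measure Ω} {s : I → Ω → ℝ≥0∞}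
  {F : U × Ω → ℝ≥0∞} {g : U × Z → ℝ≥0∞} {avg : Ω → ℝ≥0∞} {t : Ω → Z} {c : I → U} {N a : ℝ≥0∞}
  {e : ι → I}

theorem setLIntegral_sum_likelihood (hF : Measurable F)
    (hg : Measurable g)
    (h : ∀ u, ∀ C, MeasurableSet C →
      ∫⁻ ω in t ⁻¹' C, F (u, ω) ∂P = ∫⁻ z in C, g (u, z) ∂(P.map t))
    (ha : N⁻¹ = a * (Fintype.card ι : ℝ≥0∞)⁻¹) {C : Set Z} (hC : MeasurableSet C) :
    ∫⁻ ω in t ⁻¹' C, ∑ l, F (c (e l), ω) / N ∂P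
      = a * ∫⁻ z in C, codeAverage e (fun u => g (u, z)) c ∂(P.map t) := by
  have hFm : ∀ l, Measurable fun ω => F (c (e l), ω) := fun l => measurable_fiber hF _
  have hgm : ∀ l, Measurable fun z => g (c (e l), z) := fun l => measurable_fiber hg _
  simp only [codeAverage, div_eq_mul_inv, ← Finset.sum_mul]
  rw [lintegral_mul_const _ (Finset.measurable_sum _ fun l _ => hFm l),
    lintegral_mul_const _ (Finset.measurable_sum _ fun l _ => hgm l),
    lintegral_finsetSum _ fun l _ => hFm l, lintegral_finsetSum _ fun l _ => hgm l, ha]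
  simp only [h _ C hC]
  ring

/-- Here `a` is the ideal mass of one pair `(w, k)` and `e` lists its codewords. Two replacements
are paid for: weights by normalized likelihoods, using `1 ≤ avg + (1 - avg)`, and the average output
density by one. -/
theorem keyMass_le (hF : Measurable F)
    (hg : Measurable g) (hs : ∀ i, Measurable (s i)) (havg : Measurable avg)
    (h : ∀ u, ∀ C, MeasurableSet C →
      ∫⁻ ω in t ⁻¹' C, F (u, ω) ∂P = ∫⁻ z in C, g (u, z) ∂(P.map t))
    (ha : N⁻¹ = a * (Fintype.card ι : ℝ≥0∞)⁻¹)
    (hsF : ∀ i ω, s i ω * avg ω = F (c i, ω) / N) {C : Set Z} (hC : MeasurableSet C) :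
    ∫⁻ ω in t ⁻¹' C, ∑ l, s (e l) ω ∂P ≤ a * (P.map t) C
      + (∫⁻ ω, ∑ l, s (e l) ω * (1 - avg ω) ∂P
        + a * ∫⁻ z, (codeAverage e (fun u => g (u, z)) c - 1) ∂(P.map t)) := by
  have hpt : ∀ ω, ∑ l, s (e l) ω
      ≤ ∑ l, F (c (e l), ω) / N + ∑ l, s (e l) ω * (1 - avg ω) := by
    intro ω
    rw [← Finset.sum_add_distrib]
    refine Finset.sum_le_sum fun l _ => ?_
    rw [← hsF, ← mul_add]
    exact le_mul_of_one_le_right' le_add_tsub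
  have hm : Measurable fun ω => ∑ l, s (e l) ω * (1 - avg ω) :=
    Finset.measurable_sum _ fun l _ => (hs _).mul (havg.const_sub 1)
  have hga : Measurable fun z => codeAverage e (fun u => g (u, z)) c :=
    measurable_fiber (measurable_codeAverage_prod e hg) c
  calc ∫⁻ ω in t ⁻¹' C, ∑ l, s (e l) ω ∂P
      ≤ ∫⁻ ω in t ⁻¹' C, (∑ l, F (c (e l), ω) / N + ∑ l, s (e l) ω * (1 - avg ω)) ∂P :=
        lintegral_mono hpt
    _ = a * ∫⁻ z in C, codeAverage e (fun u => g (u, z)) c ∂(P.map t)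
        + ∫⁻ ω in t ⁻¹' C, ∑ l, s (e l) ω * (1 - avg ω) ∂P := by
        rw [lintegral_add_right _ hm, setLIntegral_sum_likelihood hF hg h ha hC]
    _ ≤ a * ((P.map t) C + ∫⁻ z, (codeAverage e (fun u => g (u, z)) c - 1) ∂(P.map t))
        + ∫⁻ ω, ∑ l, s (e l) ω * (1 - avg ω) ∂P := by
        refine add_le_add (mul_le_mul_right ?_ _) (setLIntegral_le_lintegral _ _)
        calc ∫⁻ z in C, codeAverage e (fun u => g (u, z)) c ∂(P.map t)
            ≤ ∫⁻ z in C, (1 + (codeAverage e (fun u => g (u, z)) c - 1)) ∂(P.map t) :=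
              lintegral_mono fun z => le_add_tsub
          _ ≤ _ := by
              rw [lintegral_add_left measurable_const, setLIntegral_one]
              exact add_le_add_right (setLIntegral_le_lintegral _ _) _
    _ = _ := by ring

/-- The counterpart of `keyMass_le`, with excess and deficit exchanged. -/
theorem le_keyMass (hF : Measurable F)
    (hg : Measurable g) (hs : ∀ i, Measurable (s i))
    (h : ∀ u, ∀ C, MeasurableSet C →
      ∫⁻ ω in t ⁻¹' C, F (u, ω) ∂P = ∫⁻ z in C, g (u, z) ∂(P.map t))
    (ha : N⁻¹ = a * (Fintype.card ι : ℝ≥0∞)⁻¹)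
    (hsF : ∀ i ω, s i ω * avg ω = F (c i, ω) / N) {C : Set Z} (hC : MeasurableSet C) :
    a * (P.map t) C ≤ ∫⁻ ω in t ⁻¹' C, ∑ l, s (e l) ω ∂P
      + (∫⁻ ω, ∑ l, s (e l) ω * (avg ω - 1) ∂P
        + a * ∫⁻ z, (1 - codeAverage e (fun u => g (u, z)) c) ∂(P.map t)) := by
  have hpt : ∀ ω, ∑ l, F (c (e l), ω) / N
      ≤ ∑ l, s (e l) ω + ∑ l, s (e l) ω * (avg ω - 1) := by
    intro ω
    rw [← Finset.sum_add_distrib]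
    refine Finset.sum_le_sum fun l _ => ?_
    rw [← hsF]
    calc s (e l) ω * avg ω ≤ s (e l) ω * (1 + (avg ω - 1)) := mul_le_mul_right le_add_tsub _
      _ = _ := by ring
  have hm : Measurable fun ω => ∑ l, s (e l) ω := Finset.measurable_sum _ fun l _ => hs _
  have hga : Measurable fun z => codeAverage e (fun u => g (u, z)) c :=
    measurable_fiber (measurable_codeAverage_prod e hg) c
  calc a * (P.map t) C
      ≤ a * (∫⁻ z in C, codeAverage e (fun u => g (u, z)) c ∂(P.map t)
        + ∫⁻ z, (1 - codeAverage e (fun u => g (u, z)) c) ∂(P.map t)) := by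
        refine mul_le_mul_right ?_ _
        calc (P.map t) C ≤ ∫⁻ z in C, (codeAverage e (fun u => g (u, z)) c
              + (1 - codeAverage e (fun u => g (u, z)) c)) ∂(P.map t) := by
              rw [← setLIntegral_one]
              exact lintegral_mono fun z => le_add_tsub
          _ ≤ _ := by
              rw [lintegral_add_left hga]
              exact add_le_add_right (setLIntegral_le_lintegral _ _) _
    _ = ∫⁻ ω in t ⁻¹' C, ∑ l, F (c (e l), ω) / N ∂P
        + a * ∫⁻ z, (1 - codeAverage e (fun u => g (u, z)) c) ∂(P.map t) := by
        rw [mul_add, setLIntegral_sum_likelihood hF hg h ha hC]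
    _ ≤ (∫⁻ ω in t ⁻¹' C, ∑ l, s (e l) ω ∂P + ∫⁻ ω, ∑ l, s (e l) ω * (avg ω - 1) ∂P)
        + a * ∫⁻ z, (1 - codeAverage e (fun u => g (u, z)) c) ∂(P.map t) := by
        refine add_le_add_left ?_ _
        refine (lintegral_mono hpt).trans ?_
        rw [lintegral_add_left hm]
        exact add_le_add_right (setLIntegral_le_lintegral _ _) _
    _ = _ := by ring

end KeyMass

/-! ### Achievability -/

section Achievability

variable {X Y Z U : Type*} [MeasurableSpace X] [MeasurableSpace Y] [MeasurableSpace Z]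
  [MeasurableSpace U] (P : Measure (X × Y × Z))
  (Q : Kernel X U) {M M₁ M₂ : ℕ}

/-- The codeword indices with the same message as `i`, other than `i`. -/
def competitors (i : Fin M × Fin M₁ × Fin M₂) : Finset (Fin M × Fin M₁ × Fin M₂) :=
  (Finset.univ.erase i.2).map ⟨Prod.mk i.1, Prod.mk_right_injective i.1⟩

theorem card_competitors (i : Fin M × Fin M₁ × Fin M₂) :
    (competitors i).card = M₁ * M₂ - 1 := by
  simp [competitors]

theorem notMem_competitors (i : Fin M × Fin M₁ × Fin M₂) : i ∉ competitors i := by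
  simp [competitors]

theorem mem_competitors {i : Fin M × Fin M₁ × Fin M₂} {j : Fin M₁ × Fin M₂} (h : j ≠ i.2) :
    (i.1, j) ∈ competitors i := by
  simp [competitors, Prod.ext_iff, h]

/-- The density of the law of `(U, Y)`, used as the decoding metric. -/
noncomputable def decodingMetric : U × Y → ℝ≥0∞ :=
  (lawUY P Q).rnDeriv ((lawU P Q).prod (P.map fun ω => ω.2.1))

open Classical in
/-- The indicator of the event that the codeword `c i` is not the unique maximizer of the decoding
metric among those with the same message. -/
noncomputable def confusion (c : Fin M × Fin M₁ × Fin M₂ → U) (i : Fin M × Fin M₁ × Fin M₂)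
    (ω : X × Y × Z) : ℝ≥0∞ :=
  if ∃ j ∈ competitors i, decodingMetric P Q (c i, ω.2.1) ≤ decodingMetric P Q (c j, ω.2.1)
  then 1 else 0

theorem confusion_le_one (c : Fin M × Fin M₁ × Fin M₂ → U) (i : Fin M × Fin M₁ × Fin M₂)
    (ω : X × Y × Z) : confusion P Q c i ω ≤ 1 := by
  unfold confusion; split_ifs <;> simp

theorem measurable_confusion (i : Fin M × Fin M₁ × Fin M₂) :
    Measurable fun p : (Fin M × Fin M₁ × Fin M₂ → U) × (X × Y × Z) =>
      confusion P Q p.1 i p.2 := by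
  have hr : ∀ j : Fin M × Fin M₁ × Fin M₂, Measurable
      fun p : (Fin M × Fin M₁ × Fin M₂ → U) × (X × Y × Z) =>
        decodingMetric P Q (p.1 j, p.2.2.1) := fun j =>
    (Measure.measurable_rnDeriv _ _).comp
      (((measurable_pi_apply j).comp measurable_fst).prodMk (by fun_prop))
  refine Measurable.ite ?_ measurable_const measurable_const
  have : {p : (Fin M × Fin M₁ × Fin M₂ → U) × (X × Y × Z) | ∃ j ∈ competitors i,
      decodingMetric P Q (p.1 i, p.2.2.1) ≤ decodingMetric P Q (p.1 j, p.2.2.1)}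
      = ⋃ j ∈ competitors i, {p | decodingMetric P Q (p.1 i, p.2.2.1)
        ≤ decodingMetric P Q (p.1 j, p.2.2.1)} := by
    ext p; simp
  rw [this]
  exact Finset.measurableSet_biUnion _ fun j _ => measurableSet_le (hr i) (hr j)

/-- The mean likelihood over the whole codebook. -/
noncomputable def sourceAverage (c : Fin M × Fin M₁ × Fin M₂ → U) (ω : X × Y × Z) : ℝ≥0∞ :=
  codeAverage id (fun u => sourceLikelihood P Q (u, ω)) c

theorem measurable_sourceAverage :
    Measurable fun p : (Fin M × Fin M₁ × Fin M₂ → U) × (X × Y × Z) => sourceAverage P Q p.1 p.2 :=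
  measurable_codeAverage_prod id (measurable_sourceLikelihood P Q)

variable [IsProbabilityMeasure P]

/-- A bound on the error probability with codebook `c`. -/
noncomputable def errorBound (c : Fin M × Fin M₁ × Fin M₂ → U) : ℝ≥0∞ :=
  ∫⁻ ω, (1 - sourceAverage P Q c ω) ∂P
    + (∑ i, ∫⁻ ω, sourceLikelihood P Q (c i, ω) * confusion P Q c i ω ∂P)
      / Fintype.card (Fin M × Fin M₁ × Fin M₂)

/-- A bound on the variational distance between the law of message, key and `Z` with codebook `c`
and the law for which message and key are uniform and independent of `Z`; `g` is the density of
the codewords' output laws on `Z`. -/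
noncomputable def secrecyBound (g : U × Z → ℝ≥0∞) (c : Fin M × Fin M₁ × Fin M₂ → U) : ℝ≥0∞ :=
  (∫⁻ ω, (1 - sourceAverage P Q c ω) ∂P + ∫⁻ ω, (sourceAverage P Q c ω - 1) ∂P)
    + ∑ k : Fin M₁, ∑ w : Fin M, ((M * M₁ : ℕ) : ℝ≥0∞)⁻¹ *
      (∫⁻ z, (codeAverage (fun l => (w, k, l)) (fun u => g (u, z)) c - 1) ∂(P.map fun ω => ω.2.2)
      + ∫⁻ z, (1 - codeAverage (fun l => (w, k, l)) (fun u => g (u, z)) c)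
          ∂(P.map fun ω => ω.2.2))

theorem measurable_errorBound :
    Measurable (errorBound P Q : (Fin M × Fin M₁ × Fin M₂ → U) → ℝ≥0∞) := by
  have hF : ∀ i : Fin M × Fin M₁ × Fin M₂, Measurable
      fun p : (Fin M × Fin M₁ × Fin M₂ → U) × (X × Y × Z) =>
        sourceLikelihood P Q (p.1 i, p.2) := fun i =>
    (measurable_sourceLikelihood P Q).comp
      (((measurable_pi_apply i).comp measurable_fst).prodMk measurable_snd)
  refine ((measurable_sourceAverage P Q).const_sub 1).lintegral_prod_right'.add
    (Measurable.div_const (Finset.measurable_sum _ fun i _ => ?_) _)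
  exact ((hF i).mul (measurable_confusion P Q i)).lintegral_prod_right'

theorem measurable_secrecyBound {g : U × Z → ℝ≥0∞} (hg : Measurable g) :
    Measurable (secrecyBound P Q g : (Fin M × Fin M₁ × Fin M₂ → U) → ℝ≥0∞) := by
  have hPm : IsProbabilityMeasure (P.map fun ω => ω.2.2) :=
    Measure.isProbabilityMeasure_map (by fun_prop)
  have hs := measurable_sourceAverage P Q (M := M) (M₁ := M₁) (M₂ := M₂)
  refine ((hs.const_sub 1).lintegral_prod_right'.add (hs.sub_const 1).lintegral_prod_right').add
    (Finset.measurable_sum _ fun k _ => Finset.measurable_sum _ fun w _ =>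
      Measurable.const_mul ?_ _)
  have ha := measurable_codeAverage_prod (fun l : Fin M₂ => (w, k, l)) hg
  exact (ha.sub_const 1).lintegral_prod_right'.add (ha.const_sub 1).lintegral_prod_right'

section Moments

variable [IsMarkovKernel Q] [NeZero M] [NeZero M₁] [NeZero M₂]

theorem lintegral_errorBound_le :
    ∫⁻ c, errorBound P Q c ∂(Measure.pi fun _ : Fin M × Fin M₁ × Fin M₂ => lawU P Q)
      ≤ ENNReal.ofReal (T₃ P Q M M₁ M₂) + ENNReal.ofReal (decodingBound (lawUY P Q) (M₁ * M₂)) := by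
  have hm : Measurable fun ω : X × Y × Z => ω.2.1 := by fun_prop
  have hF : ∀ i : Fin M × Fin M₁ × Fin M₂, Measurable
      fun p : (Fin M × Fin M₁ × Fin M₂ → U) × (X × Y × Z) =>
        sourceLikelihood P Q (p.1 i, p.2) := fun i =>
    (measurable_sourceLikelihood P Q).comp
      (((measurable_pi_apply i).comp measurable_fst).prodMk measurable_snd)
  have hi : ∀ i : Fin M × Fin M₁ × Fin M₂, Measurable fun c : Fin M × Fin M₁ × Fin M₂ → U =>
      ∫⁻ ω, sourceLikelihood P Q (c i, ω) * confusion P Q c i ω ∂P := fun i =>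
    ((hF i).mul (measurable_confusion P Q i)).lintegral_prod_right'
  have h3 := lintegral_source_codeAverage_le P Q (I := Fin M × Fin M₁ × Fin M₂)
    Function.injective_id
  have hcard : Fintype.card (Fin M × Fin M₁ × Fin M₂) = M * M₁ * M₂ := by simp [mul_assoc]
  simp only [errorBound, div_eq_mul_inv]
  rw [lintegral_add_left ((measurable_sourceAverage P Q).const_sub 1).lintegral_prod_right',
    lintegral_mul_const _ (Finset.measurable_sum _ fun i _ => hi i),
    lintegral_finsetSum _ fun i _ => hi i]
  refine add_le_add ?_ ?_
  · rw [hcard] at h3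
    exact h3
  · rw [← div_eq_mul_inv]
    refine ENNReal.div_le_of_le_mul ?_
    calc _ ≤ ∑ _i : Fin M × Fin M₁ × Fin M₂,
          ENNReal.ofReal (decodingBound (lawUY P Q) (M₁ * M₂)) := by
          refine Finset.sum_le_sum fun i _ => ?_
          exact lintegral_confusion_le_decodingBound (measurable_sourceLikelihood P Q)
            (withDensity_sourceLikelihood_le P Q) rfl (jointLaw_snd P Q) hm (lawUY_eq P Q)
            (notMem_competitors i) (card_competitors i).symm
      _ = _ := by rw [Finset.sum_const, Finset.card_univ, nsmul_eq_mul, mul_comm]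

/-- Deficit and excess at the source cost `T₃` each. At the output each costs `T₂` plus the singular
mass, itself at most `T₃`; the weights `1 / (M * M₁)` over all pairs sum to one. -/
theorem lintegral_secrecyBound_le {g : U × Z → ℝ≥0∞} (hg : Measurable g)
    (h : ∀ u, ∀ C, MeasurableSet C → ∫⁻ ω in (fun ω => ω.2.2) ⁻¹' C, sourceLikelihood P Q (u, ω) ∂P
      = ∫⁻ z in C, g (u, z) ∂(P.map fun ω => ω.2.2)) :
    ∫⁻ c, secrecyBound P Q g c ∂(Measure.pi fun _ : Fin M × Fin M₁ × Fin M₂ => lawU P Q)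
      ≤ 2 * ENNReal.ofReal (T₂ P Q M₂) + 4 * ENNReal.ofReal (T₃ P Q M M₁ M₂) := by
  have hPm : IsProbabilityMeasure (P.map fun ω => ω.2.2) :=
    Measure.isProbabilityMeasure_map (by fun_prop)
  have hs := measurable_sourceAverage P Q (M := M) (M₁ := M₁) (M₂ := M₂)
  have hcard : Fintype.card (Fin M × Fin M₁ × Fin M₂) = M * M₁ * M₂ := by simp [mul_assoc]
  have h3 := lintegral_source_codeAverage_le P Q (I := Fin M × Fin M₁ × Fin M₂)
    Function.injective_id
  rw [hcard] at h3
  have h3' := (lintegral_lintegral_codeAverage_sub_one_le (lawU P Q)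
    (id : Fin M × Fin M₁ × Fin M₂ → _) P (measurable_sourceLikelihood P Q)
    (lintegral_sourceLikelihood_le_one P Q)).trans h3
  set t2 := ENNReal.ofReal (T₂ P Q M₂) with ht2
  set t3 := ENNReal.ofReal (T₃ P Q M M₁ M₂) with ht3
  have ha := fun (w : Fin M) (k : Fin M₁) =>
    measurable_codeAverage_prod (fun l : Fin M₂ => (w, k, l)) hg
  have hinj : ∀ (w : Fin M) (k : Fin M₁), Function.Injective fun l : Fin M₂ => (w, k, l) :=
    fun w k l l' hl => by simpa using hl
  have h2 : ∀ (w : Fin M) (k : Fin M₁), ∫⁻ c, ∫⁻ z,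
      (1 - codeAverage (fun l => (w, k, l)) (fun u => g (u, z)) c) ∂(P.map fun ω => ω.2.2)
        ∂(Measure.pi fun _ : Fin M × Fin M₁ × Fin M₂ => lawU P Q) ≤ t2 + t3 := by
    intro w k
    refine (lintegral_output_codeAverage_le P Q (hinj w k) hg h).trans ?_
    rw [Fintype.card_fin]
    exact add_le_add_right (singularMass_le P Q _) _
  have h2' : ∀ (w : Fin M) (k : Fin M₁), ∫⁻ c, ∫⁻ z,
      (codeAverage (fun l => (w, k, l)) (fun u => g (u, z)) c - 1) ∂(P.map fun ω => ω.2.2)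
        ∂(Measure.pi fun _ : Fin M × Fin M₁ × Fin M₂ => lawU P Q) ≤ t2 + t3 := fun w k =>
    (lintegral_lintegral_codeAverage_sub_one_le (lawU P Q) _ _ hg
      (lintegral_output_density_le_one P Q hg h)).trans (h2 w k)
  have hwk : ∀ (w : Fin M) (k : Fin M₁), Measurable fun c : Fin M × Fin M₁ × Fin M₂ → U =>
      (∫⁻ z, (codeAverage (fun l => (w, k, l)) (fun u => g (u, z)) c - 1) ∂(P.map fun ω => ω.2.2)
      + ∫⁻ z, (1 - codeAverage (fun l => (w, k, l)) (fun u => g (u, z)) c)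
          ∂(P.map fun ω => ω.2.2)) := fun w k =>
    ((ha w k).sub_const 1).lintegral_prod_right'.add ((ha w k).const_sub 1).lintegral_prod_right'
  have hM : ((M * M₁ : ℕ) : ℝ≥0∞) ≠ 0 := by
    exact_mod_cast mul_ne_zero (NeZero.ne M) (NeZero.ne M₁)
  unfold secrecyBound
  have hss : Measurable fun c : Fin M × Fin M₁ × Fin M₂ → U =>
      ∫⁻ ω, (1 - sourceAverage P Q c ω) ∂P + ∫⁻ ω, (sourceAverage P Q c ω - 1) ∂P :=
    (hs.const_sub 1).lintegral_prod_right'.add (hs.sub_const 1).lintegral_prod_right'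
  rw [lintegral_add_left hss,
    lintegral_add_left (hs.const_sub 1).lintegral_prod_right',
    lintegral_finsetSum _ fun k _ => Finset.measurable_sum _ fun w _ => (hwk w k).const_mul _]
  have hsum : ∑ k : Fin M₁, ∫⁻ c : Fin M × Fin M₁ × Fin M₂ → U,
      ∑ w : Fin M, ((M * M₁ : ℕ) : ℝ≥0∞)⁻¹ *
      (∫⁻ z, (codeAverage (fun l => (w, k, l)) (fun u => g (u, z)) c - 1) ∂(P.map fun ω => ω.2.2)
      + ∫⁻ z, (1 - codeAverage (fun l => (w, k, l)) (fun u => g (u, z)) c)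
          ∂(P.map fun ω => ω.2.2)) ∂(Measure.pi fun _ => lawU P Q)
      ≤ 2 * (t2 + t3) := by
    calc _ ≤ ∑ _k : Fin M₁, ∑ _w : Fin M, ((M * M₁ : ℕ) : ℝ≥0∞)⁻¹ * (2 * (t2 + t3)) := by
          refine Finset.sum_le_sum fun k _ => ?_
          rw [lintegral_finsetSum _ fun w _ => (hwk w k).const_mul _]
          refine Finset.sum_le_sum fun w _ => ?_
          rw [lintegral_const_mul _ (hwk w k),
            lintegral_add_left ((ha w k).sub_const 1).lintegral_prod_right', two_mul]
          exact mul_le_mul_right (add_le_add (h2' w k) (h2 w k)) _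
      _ = (((M * M₁ : ℕ) : ℝ≥0∞) * ((M * M₁ : ℕ) : ℝ≥0∞)⁻¹) * (2 * (t2 + t3)) := by
          simp only [Finset.sum_const, Finset.card_univ, Fintype.card_fin, nsmul_eq_mul]
          push_cast
          ring
      _ = _ := by rw [ENNReal.mul_inv_cancel hM (ENNReal.natCast_ne_top _), one_mul]
  calc _ ≤ (t3 + t3) + 2 * (t2 + t3) := add_le_add (add_le_add h3 h3') hsum
    _ = _ := by ring

end Moments

end Achievability

/-! ### Error probability and leakage for a fixed codebook -/

section Scheme

variable {X Y Z U : Type*} [MeasurableSpace X] [MeasurableSpace Y] [MeasurableSpace Z]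
  [MeasurableSpace U] (P : Measure (X × Y × Z)) [IsProbabilityMeasure P]
  {M M₁ M₂ : ℕ} [NeZero M₁]

theorem leakage_le_logb (S : Scheme X Y M M₁) : S.leakage P ≤ Real.logb 2 M₁ :=
  sub_le_self _ (condEntropy_nonneg _)

variable (Q : Kernel X U) [NeZero M] [NeZero M₂]

/-- The likelihood encoder with codebook `c` and a maximum likelihood decoder. -/
theorem exists_scheme_error_le (c : Fin M × Fin M₁ × Fin M₂ → U) :
    ∃ S : Scheme X Y M M₁, S.enc = encoder P Q c ∧
      S.law P {ω | S.dec (ω.2.1, ω.1.2.1) ≠ ω.2.2} ≤ errorBound P Q c := by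
  have hr : ∀ u : U, Measurable fun y : Y => decodingMetric P Q (u, y) := fun u =>
    (Measure.measurable_rnDeriv _ _).comp measurable_prodMk_left
  have hex := fun w : Fin M => exists_measurable_argmax
    (r := fun (j : Fin M₁ × Fin M₂) (y : Y) => decodingMetric P Q (c (w, j), y))
    fun j => hr (c (w, j))
  choose s hs hmax using hex
  let S : Scheme X Y M M₁ :=
    { enc := encoder P Q c
      isMarkovKernel_enc := inferInstance
      dec := fun p => (s p.1 p.2).1
      measurable_dec := measurable_from_prod_countable_right fun w =>
        measurable_fst.comp (hs w) }
  refine ⟨S, rfl, ?_⟩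
  have hE : MeasurableSet {ω : (X × Y × Z) × (Fin M × Fin M₁) |
      S.dec (ω.2.1, ω.1.2.1) ≠ ω.2.2} := by
    have h1 : Measurable fun ω : (X × Y × Z) × (Fin M × Fin M₁) => S.dec (ω.2.1, ω.1.2.1) :=
      S.measurable_dec.comp (by fun_prop)
    have h2 : Measurable fun ω : (X × Y × Z) × (Fin M × Fin M₁) => ω.2.2 := by fun_prop
    exact (measurableSet_eq_fun h1 h2).compl
  rw [law_apply P Q c S rfl hE]
  have hF : ∀ i, Measurable fun ω => sourceLikelihood P Q (c i, ω) := fun i =>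
    measurable_fiber (measurable_sourceLikelihood P Q) (c i)
  have hconf : ∀ i, Measurable fun ω => confusion P Q c i ω := fun i =>
    measurable_fiber (measurable_confusion P Q i) c
  have havg : Measurable fun ω => sourceAverage P Q c ω :=
    measurable_fiber (measurable_sourceAverage P Q) c
  have hpt : ∀ ω : X × Y × Z, ∑ i, encWeight P Q c i ω.1
        * {ω : (X × Y × Z) × (Fin M × Fin M₁) | S.dec (ω.2.1, ω.1.2.1) ≠ ω.2.2}.indicator 1
          (ω, (i.1, i.2.1))
      ≤ (1 - sourceAverage P Q c ω) + (∑ i, sourceLikelihood P Q (c i, ω) * confusion P Q c i ω)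
          * (Fintype.card (Fin M × Fin M₁ × Fin M₂) : ℝ≥0∞)⁻¹ := by
    intro ω
    -- The decoder maximizes over pairs `(k, l)`, so a wrong key means that a competitor ties or
    -- beats the true codeword. Confusion also counts a wrong `l` and ties, which only weakens the
    -- bound.
    have hind : ∀ i : Fin M × Fin M₁ × Fin M₂,
        {ω : (X × Y × Z) × (Fin M × Fin M₁) | S.dec (ω.2.1, ω.1.2.1) ≠ ω.2.2}.indicator
          (1 : (X × Y × Z) × (Fin M × Fin M₁) → ℝ≥0∞) (ω, (i.1, i.2.1)) ≤ confusion P Q c i ω := by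
      intro i
      by_cases hi : (s i.1 ω.2.1).1 = i.2.1
      · rw [Set.indicator_of_notMem (by simpa [S] using hi)]
        exact zero_le
      · have hne : s i.1 ω.2.1 ≠ i.2 := fun h => hi (by rw [h])
        have : confusion P Q c i ω = 1 :=
          if_pos ⟨_, mem_competitors hne, hmax i.1 ω.2.1 i.2⟩
        rw [this]
        exact Set.indicator_le_self' (fun _ _ => zero_le) _
    have hterm : ∀ i, encWeight P Q c i ω.1 * confusion P Q c i ω
        ≤ encWeight P Q c i ω.1 * (1 - sourceAverage P Q c ω)
          + sourceLikelihood P Q (c i, ω) * confusion P Q c i ω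
            * (Fintype.card (Fin M × Fin M₁ × Fin M₂) : ℝ≥0∞)⁻¹ := by
      intro i
      calc encWeight P Q c i ω.1 * confusion P Q c i ω
          ≤ encWeight P Q c i ω.1 * ((1 - sourceAverage P Q c ω) + sourceAverage P Q c ω)
            * confusion P Q c i ω := by
            gcongr
            exact le_mul_of_one_le_right' le_tsub_add
        _ = encWeight P Q c i ω.1 * (1 - sourceAverage P Q c ω) * confusion P Q c i ω
            + encWeight P Q c i ω.1 * sourceAverage P Q c ω * confusion P Q c i ω := by ring
        _ ≤ _ := by
            refine add_le_add (mul_le_of_le_one_right' (confusion_le_one P Q c i ω)) ?_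
            rw [sourceAverage, encWeight_mul_codeAverage, div_eq_mul_inv]
            exact le_of_eq (by ring)
    calc _ ≤ ∑ i, (encWeight P Q c i ω.1 * (1 - sourceAverage P Q c ω)
          + sourceLikelihood P Q (c i, ω) * confusion P Q c i ω
            * (Fintype.card (Fin M × Fin M₁ × Fin M₂) : ℝ≥0∞)⁻¹) :=
          Finset.sum_le_sum fun i _ => (mul_le_mul_right (hind i) _).trans (hterm i)
      _ = _ := by
          rw [Finset.sum_add_distrib, ← Finset.sum_mul, ← Finset.sum_mul, sum_encWeight, one_mul]
  refine (lintegral_mono hpt).trans (le_of_eq ?_)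
  have hFc : ∀ i, Measurable fun ω => sourceLikelihood P Q (c i, ω) * confusion P Q c i ω :=
    fun i => (hF i).mul (hconf i)
  rw [lintegral_add_left (havg.const_sub 1), lintegral_mul_const _
    (Finset.measurable_sum _ fun i _ => hFc i), lintegral_finsetSum _ fun i _ => hFc i,
    errorBound, div_eq_mul_inv]

theorem leakage_le_secrecyBound {g : U × Z → ℝ≥0∞} (hg : Measurable g)
    (h : ∀ u, ∀ C, MeasurableSet C → ∫⁻ ω in (fun ω => ω.2.2) ⁻¹' C, sourceLikelihood P Q (u, ω) ∂P
      = ∫⁻ z in C, g (u, z) ∂(P.map fun ω => ω.2.2))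
    (c : Fin M × Fin M₁ × Fin M₂ → U) (S : Scheme X Y M M₁) (hS : S.enc = encoder P Q c)
    (hfin : secrecyBound P Q g c ≠ ∞) :
    S.leakage P ≤ (Real.log M₁ + 1) * (secrecyBound P Q g c).toReal / Real.log 2 := by
  have hm : Measurable fun ω : X × Y × Z => ω.2.2 := by fun_prop
  have hPm : IsProbabilityMeasure (P.map fun ω : X × Y × Z => ω.2.2) :=
    Measure.isProbabilityMeasure_map hm.aemeasurable
  have hK : Measurable fun ω : (X × Y × Z) × (Fin M × Fin M₁) => ω.2.2 := by fun_prop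
  have hV : Measurable fun ω : (X × Y × Z) × (Fin M × Fin M₁) => (ω.2.1, ω.1.2.2) := by fun_prop
  set a : ℝ≥0∞ := ((M * M₁ : ℕ) : ℝ≥0∞)⁻¹ with ha
  have hM : ((M * M₁ : ℕ) : ℝ≥0∞) ≠ 0 := by
    exact_mod_cast mul_ne_zero (NeZero.ne M) (NeZero.ne M₁)
  have haN : (Fintype.card (Fin M × Fin M₁ × Fin M₂) : ℝ≥0∞)⁻¹
      = a * (Fintype.card (Fin M₂) : ℝ≥0∞)⁻¹ := by
    rw [ha, ← ENNReal.mul_inv (Or.inl hM) (Or.inl (ENNReal.natCast_ne_top _))]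
    simp [mul_assoc]
  set s : Fin M × Fin M₁ × Fin M₂ → X × Y × Z → ℝ≥0∞ := fun i ω => encWeight P Q c i ω.1 with hs
  have hsm : ∀ i, Measurable (s i) := fun i => (measurable_encWeight P Q c i).comp measurable_fst
  have havg : Measurable (sourceAverage P Q c) :=
    measurable_fiber (measurable_sourceAverage P Q) c
  have hsF : ∀ i ω, s i ω * sourceAverage P Q c ω = sourceLikelihood P Q (c i, ω)
      / (Fintype.card (Fin M × Fin M₁ × Fin M₂) : ℝ≥0∞) := fun i ω =>
    encWeight_mul_codeAverage P Q c i ω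
  have hF := measurable_sourceLikelihood P Q
  set pE : Fin M₁ → ℝ≥0∞ := fun k => ∑ w : Fin M,
    (∫⁻ ω, ∑ l : Fin M₂, s (w, k, l) ω * (1 - sourceAverage P Q c ω) ∂P
      + a * ∫⁻ z, (codeAverage (fun l => (w, k, l)) (fun u => g (u, z)) c - 1)
        ∂(P.map fun ω => ω.2.2)) with hpE
  set qE : Fin M₁ → ℝ≥0∞ := fun k => ∑ w : Fin M,
    (∫⁻ ω, ∑ l : Fin M₂, s (w, k, l) ω * (sourceAverage P Q c ω - 1) ∂P
      + a * ∫⁻ z, (1 - codeAverage (fun l => (w, k, l)) (fun u => g (u, z)) c)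
        ∂(P.map fun ω => ω.2.2)) with hqE
  -- The encoder weights sum to one, so the source deviation is charged once in total, not once per
  -- key and message.
  have hweights : ∀ b : X × Y × Z → ℝ≥0∞, Measurable b →
      ∑ k : Fin M₁, ∑ w : Fin M, ∫⁻ ω, ∑ l : Fin M₂, s (w, k, l) ω * b ω ∂P = ∫⁻ ω, b ω ∂P := by
    intro b hb
    have hmeas : ∀ w k, Measurable fun ω => ∑ l : Fin M₂, s (w, k, l) ω * b ω := fun w k =>
      Finset.measurable_sum _ fun l _ => (hsm _).mul hb
    rw [Finset.sum_comm]
    simp_rw [← lintegral_finsetSum Finset.univ fun k _ => hmeas _ k]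
    rw [← lintegral_finsetSum _ fun w _ => Finset.measurable_sum _ fun k _ => hmeas w k]
    refine lintegral_congr fun ω => ?_
    have : ∑ i : Fin M × Fin M₁ × Fin M₂, s i ω * b ω = b ω := by
      rw [← Finset.sum_mul, hs]
      simp only
      rw [sum_encWeight, one_mul]
    simpa only [Fintype.sum_prod_type] using this
  have htotal : ∑ k, (pE k + qE k) = secrecyBound P Q g c := by
    simp only [hpE, hqE, Finset.sum_add_distrib]
    rw [hweights _ (havg.const_sub 1), hweights _ (havg.sub_const 1), secrecyBound]
    simp only [mul_add, Finset.sum_add_distrib, ← ha]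
    ring
  have hpqfin : ∀ k, pE k + qE k ≠ ∞ := fun k => by
    have := ENNReal.sum_ne_top.1 (htotal ▸ hfin) k (Finset.mem_univ k)
    exact this
  have hpfin : ∀ k, pE k ≠ ∞ := fun k => ne_top_of_le_ne_top (hpqfin k) le_self_add
  have hqfin : ∀ k, qE k ≠ ∞ := fun k => ne_top_of_le_ne_top (hpqfin k) le_add_self
  -- The common reference: message and key uniform and independent of `Z`, restricted to any one
  -- key.
  let ρE : Set (Fin M × Z) → ℝ≥0∞ := fun B =>
    ∑ w : Fin M, a * (P.map fun ω => ω.2.2) (Prod.mk w ⁻¹' B)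
  have hρfin : ∀ B, ρE B ≠ ∞ := fun B => ENNReal.sum_ne_top.2 fun w _ =>
    ENNReal.mul_ne_top (ENNReal.inv_ne_top.2 hM) (measure_ne_top _ _)
  have hlaw : ∀ (k : Fin M₁) (B : Set (Fin M × Z)), MeasurableSet B →
      S.law P ((fun ω => (ω.2.1, ω.1.2.2)) ⁻¹' B ∩ (fun ω => ω.2.2) ⁻¹' {k})
      = ∑ w : Fin M, ∫⁻ ω in (fun ω => ω.2.2) ⁻¹' (Prod.mk w ⁻¹' B),
          ∑ l : Fin M₂, s (w, k, l) ω ∂P := by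
    intro k B hB
    have hBw : ∀ w : Fin M, MeasurableSet ((fun ω : X × Y × Z => ω.2.2) ⁻¹' (Prod.mk w ⁻¹' B)) :=
      fun w => hm (measurable_prodMk_left hB)
    rw [law_apply P Q c S hS ((hV hB).inter (hK (measurableSet_singleton k)))]
    simp_rw [← lintegral_indicator (hBw _)]
    rw [← lintegral_finsetSum _ fun w _ =>
      (Finset.measurable_sum _ fun l _ => hsm (w, k, l)).indicator (hBw w)]
    refine lintegral_congr fun ω => ?_
    simp only [Fintype.sum_prod_type]
    refine Finset.sum_congr rfl fun w _ => ?_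
    rw [Finset.sum_eq_single k (fun k' _ hk => by simp [hk]) (by simp)]
    by_cases hw : (w, ω.2.2) ∈ B
    · simp [hw, hs]
    · simp [hw]
  have key := logb_card_sub_condEntropy_le (S.law P) hK hV (fun B => (ρE B).toReal)
    (fun k => (pE k).toReal) (fun k => (qE k).toReal) ?_ ?_
  · have hsum : ∑ k, ((pE k).toReal + (qE k).toReal) = (secrecyBound P Q g c).toReal := by
      rw [← htotal, ENNReal.toReal_sum fun k _ => hpqfin k]
      exact Finset.sum_congr rfl fun k _ => (ENNReal.toReal_add (hpfin k) (hqfin k)).symm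
    rw [hsum, Fintype.card_fin] at key
    exact key
  · intro k B hB
    rw [← ENNReal.toReal_add (hρfin B) (hpfin k), measureReal_def]
    refine ENNReal.toReal_mono (ENNReal.add_ne_top.2 ⟨hρfin B, hpfin k⟩) ?_
    rw [hlaw k B hB, ← Finset.sum_add_distrib]
    exact Finset.sum_le_sum fun w _ => keyMass_le (e := fun l => (w, k, l)) hF hg hsm havg h haN
      hsF (measurable_prodMk_left hB)
  · intro k B hB
    rw [measureReal_def, ← ENNReal.toReal_add (measure_ne_top _ _) (hqfin k)]
    refine ENNReal.toReal_mono (ENNReal.add_ne_top.2 ⟨measure_ne_top _ _, hqfin k⟩) ?_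
    rw [hlaw k B hB, ← Finset.sum_add_distrib]
    exact Finset.sum_le_sum fun w _ => le_keyMass (e := fun l => (w, k, l)) hF hg hsm h haN
      hsF (measurable_prodMk_left hB)

end Scheme

/-! ### Signs of the bounds -/

section Bounds

variable {A B : Type*} [MeasurableSpace A] [MeasurableSpace B] (ν : Measure (A × B))

theorem coveringBound_nonneg (N : ℕ) : 0 ≤ coveringBound ν N :=
  Real.iInf_nonneg fun τ => by positivity

/-- Strictness is what allows division by the two means when a codebook is selected; it holds
because `τ > 0` keeps the square root term above `√(1 / N) / 2`. -/
theorem coveringBound_pos {N : ℕ} (hN : N ≠ 0) : 0 < coveringBound ν N := by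
  have hN' : (0 : ℝ) < N := by exact_mod_cast Nat.pos_of_ne_zero hN
  have h0 : (0 : ℝ) < 1 / 2 * √(1 / N) := by positivity
  refine h0.trans_le (le_ciInf fun τ => ?_)
  have h1 : (1 : ℝ) ≤ (2 : ℝ) ^ (τ : ℝ) := Real.one_le_rpow one_le_two (le_of_lt τ.2)
  have h2 : 1 / 2 * √(1 / (N : ℝ)) ≤ 1 / 2 * √((2 : ℝ) ^ (τ : ℝ) / N) := by gcongr
  exact h2.trans (le_add_of_nonneg_left measureReal_nonneg)

theorem decodingBound_nonneg (N : ℕ) : 0 ≤ decodingBound ν N :=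
  Real.iInf_nonneg fun γ => by positivity

end Bounds

end OneShotKey

theorem theorem7 {X Y Z U : Type*} [MeasurableSpace X] [MeasurableSpace Y] [MeasurableSpace Z]
    [MeasurableSpace U] (P : MeasureTheory.Measure (X × Y × Z))
    [MeasureTheory.IsProbabilityMeasure P]
    (Q : ProbabilityTheory.Kernel X U) [ProbabilityTheory.IsMarkovKernel Q]
    (M M₁ M₂ : ℕ) [NeZero M] [NeZero M₁] [NeZero M₂] :
    ∃ S : OneShotKey.Scheme X Y M M₁,
      (∃ c : Fin M × Fin M₁ × Fin M₂ → U, ∀ (x : X) (w : Fin M) (k : Fin M₁),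
        (S.enc x).real {(w, k)} =
          ∑ l : Fin M₂, OneShotKey.likelihoodEncoder P Q c x (w, k, l)) ∧
      S.errorProb P ≤ OneShotKey.εStar P Q M M₁ M₂ ∧
      S.leakage P ≤ ⨅ δ : Set.Ioo (0 : ℝ) (Real.exp (-1) * (M₁ : ℝ) ^ (3 / 2 : ℝ)),
        (OneShotKey.TStar P Q M M₁ M₂ + 8 * (δ : ℝ)) *
          Real.logb 2 ((M₁ : ℝ) ^ (3 / 2 : ℝ) / (δ : ℝ)) := by
  open OneShotKey in
  have hM1 : (0 : ℝ) < M₁ := by exact_mod_cast NeZero.pos M₁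
  obtain ⟨g, hg, h⟩ := exists_density_map P (t := fun ω : X × Y × Z => ω.2.2) (by fun_prop)
    (measurable_sourceLikelihood P Q)
  have hT1 : 0 ≤ T₁ P Q M M₂ := coveringBound_nonneg _ _
  have hT2 : 0 ≤ T₂ P Q M₂ := coveringBound_nonneg _ _
  have hT3 : 0 < T₃ P Q M M₁ M₂ := coveringBound_pos _
    (mul_ne_zero (mul_ne_zero (NeZero.ne M) (NeZero.ne M₁)) (NeZero.ne M₂))
  have hε : 0 ≤ decodingBound (lawUY P Q) (M₁ * M₂) := decodingBound_nonneg _ _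
  have hA := lintegral_errorBound_le P Q (M := M) (M₁ := M₁) (M₂ := M₂)
  rw [← ENNReal.ofReal_add hT3.le hε] at hA
  have hB := lintegral_secrecyBound_le P Q (M := M) (M₁ := M₁) (M₂ := M₂) hg h
  have hB' : 2 * ENNReal.ofReal (T₂ P Q M₂) + 4 * ENNReal.ofReal (T₃ P Q M M₁ M₂)
      = ENNReal.ofReal (2 * T₂ P Q M₂ + 4 * T₃ P Q M M₁ M₂) := by
    rw [ENNReal.ofReal_add (by positivity) (by positivity), ENNReal.ofReal_mul (by norm_num),
      ENNReal.ofReal_mul (by norm_num)]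
    norm_num
  rw [hB'] at hB
  obtain ⟨c, hcA, hcB⟩ := exists_le_two_mul (measurable_errorBound P Q)
    (measurable_secrecyBound P Q hg) (by positivity) (by positivity) hA hB
  obtain ⟨S, hS, hSerr⟩ := exists_scheme_error_le P Q c
  have hTpos : 0 ≤ TStar P Q M M₁ M₂ := by unfold TStar; positivity
  refine ⟨S, ⟨c, fun x w k => by rw [hS]; exact encoder_real_singleton P Q c x w k⟩, ?_, ?_⟩
  · exact ENNReal.toReal_le_of_le_ofReal (by unfold εStar; positivity) (hSerr.trans hcA)
  · have hne : Nonempty (Set.Ioo (0 : ℝ) (Real.exp (-1) * (M₁ : ℝ) ^ (3 / 2 : ℝ))) :=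
      Set.nonempty_Ioo_subtype (by positivity)
    -- The selected codebook gives `4 * T₂ + 8 * T₃`, which lies below `TStar`.
    have hD : (secrecyBound P Q g c).toReal ≤ TStar P Q M M₁ M₂ := by
      refine (ENNReal.toReal_le_of_le_ofReal (by positivity) hcB).trans ?_
      unfold TStar
      linarith
    refine le_ciInf fun δ => ?_
    exact le_mul_logb_of_le hD hTpos
      (leakage_le_secrecyBound P Q hg h c S hS (ne_top_of_le_ne_top ENNReal.ofReal_ne_top hcB))
      (leakage_le_logb P S) δ.2.1 δ.2.2
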